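/- A tournament $T$ consists of a finite vertex set $V(T)$ and a set $A(T)$ of ordered pairs of distinct vertices (arcs) such that for all $x\neq y$ in $V(T)$, $(x,y)\in A(T)$ if and only if $(y,x)\notin A(T)$. A module of $T$ is a set $M\subseteq V(T)$ such that for all $x,y\in M$ and $v\in V(T)\setminus M$, $(v,x)\in A(T)$ if and only if $(v,y)\in A(T)$; $T$ is indecomposable if its only modules are $\varnothing$, the singletons and $V(T)$. For a tournament $T$ with at least five vertices, $\delta(T)$ denotes the least number of arcs of $T$ whose reversal makes $T$ indecomposable, and for $m\geq 5$, $\delta(m)$ denotes the maximum of $\delta(U)$ over all $m$-vertex tournaments $U$. A tournament $T$ with at least five vertices has $\delta$-maximal decomposability if $\delta(T)=\delta(|V(T)|)$. Let $\underline{k}$ be the transitive tournament on $\{0,\ldots,k-1\}$ with arcs $(i,j)$, $i<j$. For a tournament $T$ and pairwise disjoint tournaments $T_i$ ($i\in V(T)$), the lexicographic sum $\Sigma_{i\in T}T_i$ is the tournament on $\bigcup_i V(T_i)$ in which, for $x\in V(T_i)$ and $y\in V(T_j)$, $(x,y)$ is an arc if and only if either $i=j$ and $(x,y)\in A(T_i)$,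 or $i\neq j$ and $(i,j)\in A(T)$. It is written $T(T_0,\ldots,T_{k-1})$ when $V(T)=\{0,\ldots,k-1\}$, and $T.H$ when every $T_i$ is a copy of $H$ (these are defined up to isomorphism). **Theorem.** Let $n\geq 2$. Up to isomorphism, the tournaments with $4n$ vertices and $\delta$-maximal decomposability are exactly the tournaments $$\underline{3}(\underline{1},\,T_{2n-1}.\underline{2},\,\underline{1}),$$ where $T_{2n-1}$ is an arbitrary tournament with $2n-1$ vertices. -/

import Mathlib

/-- A tournament with vertex set `V`: a digraph without loops in which, for all distinct vertices
`x` and `y`, the pair `(x, y)` is an arc if and only if `(y, x)` is not. -/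
structure Tournament (V : Type*) extends Digraph V where
  irrefl : ∀ x, ¬ Adj x x
  adj_iff : ∀ x y, x ≠ y → (Adj x y ↔ ¬ Adj y x)

namespace Tournament

/-- The set `A(T)` of arcs. -/
def arcs {V : Type*} (T : Tournament V) : Set (V × V) := {a | T.Adj a.1 a.2}

/-- Two tournaments are isomorphic if some bijection of the vertex sets preserves and reflects
the arcs. -/
def Isomorphic {V W : Type*} (T : Tournament V) (S : Tournament W) : Prop :=
  Nonempty (T.Adj ≃r S.Adj)

/-- `M` is a module of `T` if no vertex outside `M` distinguishes two vertices of `M`. -/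
def IsModule {V : Type*} (T : Tournament V) (M : Set V) : Prop :=
  ∀ x ∈ M, ∀ y ∈ M, ∀ v ∉ M, (T.Adj v x ↔ T.Adj v y)

/-- `T` is indecomposable if all its modules are trivial: empty, a singleton, or everything. -/
def IsIndecomposable {V : Type*} (T : Tournament V) : Prop :=
  ∀ M : Set V, T.IsModule M → M = ∅ ∨ (∃ u, M = {u}) ∨ M = Set.univ

/-- `Inv(T, B)`: the tournament obtained from `T` by reversing the arcs in `B ⊆ A(T)`; its arc set
is `(A(T) \ B) ∪ B*`, where `B*` consists of the reversed pairs. -/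
def inv {V : Type*} (T : Tournament V) (B : Set (V × V)) (hB : B ⊆ T.arcs) : Tournament V where
  Adj x y := (x, y) ∈ (T.arcs \ B) ∪ Prod.swap ⁻¹' B
  irrefl x := by
    rintro (h | h)
    · exact T.irrefl x h.1
    · exact T.irrefl x (hB h)
  adj_iff x y hxy := by
    have h := T.adj_iff x y hxy
    have h₁ : (x, y) ∈ B → T.Adj x y := fun k => hB k
    have h₂ : (y, x) ∈ B → T.Adj y x := fun k => hB k
    simp only [arcs, Set.mem_union, Set.mem_diff, Set.mem_setOf_eq, Set.mem_preimage,
      Prod.swap_prod_mk]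
    tauto

/-- The decomposability index `δ(T)`: the least number of arcs of `T` whose reversal makes `T`
indecomposable. (Such a set of arcs exists whenever `T` is finite with at least five vertices.) -/
noncomputable def decompIndex {V : Type*} (T : Tournament V) : ℕ :=
  sInf {m | ∃ (B : Finset (V × V)) (hB : (B : Set (V × V)) ⊆ T.arcs),
    B.card = m ∧ (T.inv B hB).IsIndecomposable}

/-- `δ(n)`: the maximum of `δ(U)` over the tournaments `U` with `n` vertices
(every such tournament is isomorphic to one on `Fin n`). -/
noncomputable def maxDecompIndex (n : ℕ) : ℕ :=
  sSup (Set.range fun U : Tournament (Fin n) => U.decompIndex)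

/-- `T` has `δ`-maximal decomposability: it has at least five vertices and `δ(T) = δ(v(T))`. -/
def HasMaximalDecomposability {V : Type*} (T : Tournament V) : Prop :=
  5 ≤ Nat.card V ∧ T.decompIndex = maxDecompIndex (Nat.card V)

/-- The transitive tournament on `{0, …, n - 1}`, with arcs `(i, j)` for `i < j`. -/
def transitive (n : ℕ) : Tournament (Fin n) where
  Adj i j := i < j
  irrefl i := lt_irrefl i
  adj_iff i j hij := by
    rw [not_lt]
    exact ⟨le_of_lt, fun h => lt_of_le_of_ne h hij⟩

/-- The supremum defining `δ(n)` is attained: it is a genuine maximum. -/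
theorem isGreatest_maxDecompIndex (n : ℕ) :
    IsGreatest (Set.range fun U : Tournament (Fin n) => U.decompIndex) (maxDecompIndex n) := by
  have hfin : Finite (Tournament (Fin n)) := by
    refine Finite.of_injective (fun U : Tournament (Fin n) => U.toDigraph) ?_
    rintro ⟨_, _, _⟩ ⟨_, _, _⟩ h
    cases h
    rfl
  have hb : BddAbove (Set.range fun U : Tournament (Fin n) => U.decompIndex) :=
    (Set.finite_range _).bddAbove
  exact ⟨Nat.sSup_mem ⟨_, transitive n, rfl⟩ hb, fun _ h => le_csSup hb h⟩

/-- The lexicographic sum of the tournaments `S i` over the tournament `T`, on the disjoint union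
of their vertex sets: `(x, y)` with `x` in the `i`-th and `y` in the `j`-th part is an arc if
`i = j` and it is an arc of `S i`, or if `i ≠ j` and `(i, j)` is an arc of `T`. -/
def lexSum {I : Type*} {W : I → Type*} (T : Tournament I) (S : ∀ i, Tournament (W i)) :
    Tournament (Σ i, W i) where
  Adj := Sigma.Lex T.Adj fun i => (S i).Adj
  irrefl x := by
    rw [Sigma.lex_iff]
    rintro (h | ⟨_, h⟩)
    · exact T.irrefl _ h
    · exact (S _).irrefl _ h
  adj_iff := by
    rintro ⟨i, a⟩ ⟨j, b⟩ hxy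
    by_cases hij : i = j
    · subst hij
      have hab : a ≠ b := fun h => hxy (by rw [h])
      have h := (S i).adj_iff a b hab
      have hi := T.irrefl i
      simp only [Sigma.lex_iff, hi, false_or, exists_const]
      exact h
    · have h := T.adj_iff i j hij
      simp only [Sigma.lex_iff, hij, Ne.symm hij, IsEmpty.exists_iff, or_false]
      exact h

/-- The lexicographic product `T.H`: the lexicographic sum over `T` of copies of `H`. -/
def lexProd {I W : Type*} (T : Tournament I) (H : Tournament W) : Tournament (Σ _ : I, W) :=
  T.lexSum fun _ => H

/-- The family of types `A`, `B`, `C` indexed by `0`, `1`, `2`. -/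
def triple.{u} (A B C : Type u) : Fin 3 → Type u
  | 0 => A
  | 1 => B
  | 2 => C

/-- The lexicographic sum `T(P, Q, R)` over a tournament `T` on `{0, 1, 2}`. -/
def lexSum₃.{u} {A B C : Type u} (T : Tournament (Fin 3)) (P : Tournament A) (Q : Tournament B)
    (R : Tournament C) : Tournament (Σ i, triple A B C i) :=
  T.lexSum fun
    | 0 => P
    | 1 => Q
    | 2 => R

end Tournament

/-! Call a set a comodule if it or its complement is a nontrivial module. A tournament is
indecomposable exactly when it has no comodule, so reversals must destroy every one of them. If no
reversed arc has an end in a comodule, that comodule survives; hence `k` pairwise disjoint comodules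
force at least `k / 2` reversals (`card_le_two_mul_decompIndex`).

Conversely, minimal comodules overlap only as two-element modules `{a, b}`, `{b, c}`, and such pairs
form chains. Taking every other pair of each chain yields disjoint minimal comodules `M x` whose
representatives `x ∈ X` meet every comodule (`exists_isTransversal`). Then `⌈|X| / 2⌉` reversals
suffice (`exists_isIndecomposable`): pair up `X` so as to separate as many comodules as possible and
reverse the arcs between partners. Maximality and a four-vertex argument (`not_three_splits`) leave
no old module; a local analysis (`Crossing.obstructed`) excludes new ones when at least four
vertices are paired. An odd vertex left over costs one more reversal, and two or three
representatives are treated by hand.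

Finally count. A singleton `M x` is a source or a sink, so there are at most two of them, and every
other `M x` has at least two elements: `2|X| ≤ |V| + 2`. For `|V| = 4n` this gives `δ ≤ n + 1`,
attained by the tournaments in question, whose source, sink and `2n - 1` twin pairs are `2n + 1`
disjoint comodules. If `δ(T) = n + 1`, then `|X| = 2n + 1` and the count is tight: a source, a sink
and two-element modules partition `V`, which is the asserted structure. -/

namespace Tournament

open Set

/-! ### Modules, comodules and minimal comodules -/

section Modules

variable {V : Type*} {T : Tournament V}

theorem IsModule.inter {M N : Set V} (hM : T.IsModule M) (hN : T.IsModule N) :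
    T.IsModule (M ∩ N) := by
  rintro x ⟨hx, hx'⟩ y ⟨hy, hy'⟩ v hv
  by_cases h : v ∈ M
  · exact hN x hx' y hy' v fun h' => hv ⟨h, h'⟩
  · exact hM x hx y hy v h

theorem IsModule.union {M N : Set V} (hM : T.IsModule M) (hN : T.IsModule N)
    (h : (M ∩ N).Nonempty) : T.IsModule (M ∪ N) := by
  obtain ⟨z, hz, hz'⟩ := h
  have key : ∀ x ∈ M ∪ N, ∀ v ∉ M ∪ N, (T.Adj v x ↔ T.Adj v z) := by
    rintro x (hx | hx) v hv
    · exact hM x hx z hz v fun h => hv (Or.inl h)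
    · exact hN x hx z hz' v fun h => hv (Or.inr h)
  intro x hx y hy v hv
  rw [key x hx v hv, key y hy v hv]

/-- A vertex of `M ∩ N` is joined to the points outside `N` as any `w ∈ N \ M` is, and `w` sees all
of `M` alike. -/
theorem IsModule.diff {M N : Set V} (hM : T.IsModule M) (hN : T.IsModule N)
    (h : (N \ M).Nonempty) : T.IsModule (M \ N) := by
  obtain ⟨w, hw, hw'⟩ := h
  rintro x ⟨hx, hx'⟩ y ⟨hy, hy'⟩ v hv
  by_cases h : v ∈ M
  · have hvN : v ∈ N := by_contra fun h' => hv ⟨h, h'⟩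
    have h1 := hN v hvN w hw x hx'
    have h2 := hN v hvN w hw y hy'
    have h3 := hM x hx y hy w hw'
    have a1 := T.adj_iff v x (by rintro rfl; exact hx' hvN)
    have a2 := T.adj_iff v y (by rintro rfl; exact hy' hvN)
    have a3 := T.adj_iff w x (by rintro rfl; exact hx' hw)
    have a4 := T.adj_iff w y (by rintro rfl; exact hy' hw)
    tauto
  · exact hM x hx y hy v h

variable (T) in
/-- A module that is neither empty, nor a singleton, nor the whole vertex set. -/
def IsNontrivialModule (M : Set V) : Prop :=
  T.IsModule M ∧ M.Nontrivial ∧ M ≠ univ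

variable (T) in
/-- A set that is a nontrivial module or the complement of one. -/
def IsComodule (M : Set V) : Prop :=
  T.IsNontrivialModule M ∨ T.IsNontrivialModule Mᶜ

theorem isIndecomposable_iff : T.IsIndecomposable ↔ ∀ M, ¬ T.IsNontrivialModule M := by
  constructor
  · rintro h M ⟨h1, h2, h3⟩
    rcases h M h1 with rfl | ⟨u, rfl⟩ | h4
    · exact h2.ne_empty rfl
    · exact h2.ne_singleton rfl
    · exact h3 h4
  · intro h M hM
    by_cases h2 : M.Nontrivial
    · right; right
      by_contra h3
      exact h M ⟨hM, h2, h3⟩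
    · rw [not_nontrivial_iff] at h2
      rcases h2.eq_empty_or_singleton with h | h
      · exact Or.inl h
      · exact Or.inr (Or.inl h)

theorem IsComodule.compl {M : Set V} (h : T.IsComodule M) : T.IsComodule Mᶜ := by
  unfold IsComodule at *
  rw [compl_compl]
  exact h.symm

theorem IsComodule.nonempty {M : Set V} (h : T.IsComodule M) : M.Nonempty := by
  rcases h with h | h
  · exact h.2.1.nonempty
  · rw [nonempty_iff_ne_empty]
    rintro rfl
    exact h.2.2 compl_empty

/-- The comodules that are minimal with respect to inclusion. -/
abbrev IsMinComodule (T : Tournament V) (M : Set V) : Prop := Minimal T.IsComodule M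

theorem IsMinComodule.subsingleton_of_isModule {M P : Set V} (hM : T.IsMinComodule M)
    (hP : T.IsModule P) (h : P ⊆ M) (h' : P ≠ M) : P.Subsingleton := by
  by_contra hs
  rw [not_subsingleton_iff] at hs
  refine h' (hM.eq_of_subset (Or.inl ⟨hP, hs, ?_⟩) h)
  rintro rfl
  exact h' (univ_subset_iff.mp h).symm

/-- Two distinct minimal comodules that meet are both modules with two elements. -/
theorem IsMinComodule.overlap {M N : Set V} (hM : T.IsMinComodule M) (hN : T.IsMinComodule N)
    (hne : M ≠ N) (h : (M ∩ N).Nonempty) :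
    T.IsNontrivialModule M ∧ T.IsNontrivialModule N ∧
      ∃ a b c, M = {a, b} ∧ N = {b, c} ∧ a ≠ b ∧ b ≠ c := by
  have hMN : (M \ N).Nonempty := by
    rw [sdiff_nonempty]
    intro h'
    exact hne (hN.eq_of_subset hM.prop h')
  have hNM : (N \ M).Nonempty := by
    rw [sdiff_nonempty]
    intro h'
    exact hne (hM.eq_of_subset hN.prop h').symm
  -- Otherwise `Mᶜ ⊆ N`, so `Mᶜ = N` by minimality of `N`, although `M` and `N` meet.
  have hU : (Mᶜ ∩ Nᶜ).Nonempty := by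
    by_contra h'
    rw [not_nonempty_iff_eq_empty] at h'
    have hsub : Mᶜ ⊆ N := by
      intro x hx
      by_contra hxN
      have : x ∈ Mᶜ ∩ Nᶜ := ⟨hx, hxN⟩
      rw [h'] at this
      exact this
    have heq := hN.eq_of_subset hM.prop.compl hsub
    obtain ⟨z, hz, hz'⟩ := h
    rw [← heq] at hz'
    exact hz' hz
  -- If `M` and `Nᶜ` are modules, so is `M ∪ Nᶜ`; its complement `N \ M` is then a comodule strictly
  -- inside `N`.
  have mixed : ∀ {M N : Set V}, T.IsMinComodule N → (M ∩ N).Nonempty → (N \ M).Nonempty →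
      (M \ N).Nonempty → T.IsNontrivialModule M → T.IsNontrivialModule Nᶜ → False := by
    intro M N hN h hNM hMN hM' hN'
    have h1 : T.IsModule (M ∪ Nᶜ) := hM'.1.union hN'.1 hMN
    have h2 : (M ∪ Nᶜ)ᶜ = N \ M := by ext; simp; tauto
    have h3 : T.IsComodule (N \ M) := by
      rw [← h2]
      refine IsComodule.compl (Or.inl ⟨h1, hM'.2.1.mono subset_union_left, ?_⟩)
      intro h4
      rw [h4] at h2
      rw [← h2] at hNM
      simp at hNM
    obtain ⟨z, hz, hz'⟩ := h
    have := hN.eq_of_subset h3 sdiff_subset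
    rw [← this] at hz'
    exact hz'.2 hz
  rcases hM.prop with hM' | hM' <;> rcases hN.prop with hN' | hN'
  · refine ⟨hM', hN', ?_⟩
    -- Intersection and both differences are modules properly inside minimal comodules, hence single
    -- points.
    have s1 := hM.subsingleton_of_isModule (hM'.1.inter hN'.1) inter_subset_left
      (by intro h'; obtain ⟨z, hz, hz'⟩ := hMN; rw [← h'] at hz; exact hz' hz.2)
    have s2 := hM.subsingleton_of_isModule (hM'.1.diff hN'.1 hNM) sdiff_subset
      (by intro h'; obtain ⟨z, hz, hz'⟩ := h; rw [← h'] at hz; exact hz.2 hz')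
    have s3 := hN.subsingleton_of_isModule (hN'.1.diff hM'.1 hMN) sdiff_subset
      (by intro h'; obtain ⟨z, hz, hz'⟩ := h; rw [← h'] at hz'; exact hz'.2 hz)
    obtain ⟨b, hb⟩ := h
    obtain ⟨a, ha⟩ := hMN
    obtain ⟨c, hc⟩ := hNM
    refine ⟨a, b, c, ?_, ?_, ?_, ?_⟩
    · ext z
      constructor
      · intro hz
        by_cases hzN : z ∈ N
        · exact Or.inr (s1 ⟨hz, hzN⟩ hb)
        · exact Or.inl (s2 ⟨hz, hzN⟩ ha)
      · rintro (rfl | rfl)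
        · exact ha.1
        · exact hb.1
    · ext z
      constructor
      · intro hz
        by_cases hzM : z ∈ M
        · exact Or.inl (s1 ⟨hzM, hz⟩ hb)
        · exact Or.inr (s3 ⟨hz, hzM⟩ hc)
      · rintro (rfl | rfl)
        · exact hb.2
        · exact hc.1
    · rintro rfl
      exact ha.2 hb.2
    · rintro rfl
      exact hc.2 hb.1
  · exact (mixed hN h hNM hMN hM' hN').elim
  · exact (mixed hM (by rwa [inter_comm]) hMN hNM hN' hM').elim
  -- Two complements of modules: `M ∩ N` would be a comodule strictly inside `M`.
  · have h1 : T.IsModule (Mᶜ ∪ Nᶜ) := hM'.1.union hN'.1 hU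
    have h2 : Mᶜ ∪ Nᶜ = (M ∩ N)ᶜ := by rw [compl_inter]
    have h3 : T.IsComodule (M ∩ N) := by
      refine Or.inr ⟨h2 ▸ h1, h2 ▸ hM'.2.1.mono subset_union_left, ?_⟩
      intro h4
      rw [compl_univ_iff] at h4
      exact h.ne_empty h4
    have := hM.eq_of_subset h3 inter_subset_left
    obtain ⟨z, hz, hz'⟩ := hMN
    rw [← this] at hz
    exact (hz' hz.2).elim

theorem IsComodule.exists_min [Finite V] {D : Set V} (hD : T.IsComodule D) :
    ∃ M, M ⊆ D ∧ T.IsMinComodule M := by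
  obtain ⟨M, h1, h2⟩ := (Set.toFinite {M | T.IsComodule M}).exists_le_minimal hD
  exact ⟨M, h1, h2⟩

end Modules

/-! ### Chains of twins and a disjoint transversal of the comodules -/

section Transversal

variable {V : Type*} (T : Tournament V)

/-- `a` immediately precedes `b` and the pair `{a, b}` is a minimal comodule and a module. -/
def TwinArc (a b : V) : Prop :=
  T.Adj a b ∧ T.IsNontrivialModule {a, b} ∧ T.IsMinComodule {a, b}

variable {T}

theorem adj_asymm {a b : V} (h : T.Adj a b) : ¬ T.Adj b a := by
  have hne : a ≠ b := by
    rintro rfl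
    exact T.irrefl _ h
  exact (T.adj_iff a b hne).mp h

theorem adj_ne {a b : V} (h : T.Adj a b) : a ≠ b := by
  rintro rfl
  exact T.irrefl _ h

theorem adj_total {a b : V} (h : a ≠ b) : T.Adj a b ∨ T.Adj b a := by
  have := T.adj_iff a b h
  tauto

/-- Otherwise `c` sees the twins `a`, `b` alike, forcing `b → c`, and by symmetry `c → b`. With
`pred_unique`, the twin arcs thus have in- and outdegree at most one. -/
theorem TwinArc.succ_unique {a b c : V} (h : T.TwinArc a b) (h' : T.TwinArc a c) : b = c := by
  by_contra hne
  have h1 := h.2.1.1 a (by simp) b (by simp) c (by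
    simp only [mem_insert_iff, mem_singleton_iff, not_or]
    exact ⟨(adj_ne h'.1).symm, Ne.symm hne⟩)
  have h2 := h'.2.1.1 a (by simp) c (by simp) b (by
    simp only [mem_insert_iff, mem_singleton_iff, not_or]
    exact ⟨(adj_ne h.1).symm, hne⟩)
  have h3 := T.adj_iff b c hne
  have h4 := adj_asymm h.1
  have h5 := adj_asymm h'.1
  tauto

theorem TwinArc.pred_unique {a b c : V} (h : T.TwinArc a c) (h' : T.TwinArc b c) : a = b := by
  by_contra hne
  have h1 := h.2.1.1 a (by simp) c (by simp) b (by
    simp only [mem_insert_iff, mem_singleton_iff, not_or]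
    exact ⟨Ne.symm hne, (adj_ne h'.1)⟩)
  have h2 := h'.2.1.1 b (by simp) c (by simp) a (by
    simp only [mem_insert_iff, mem_singleton_iff, not_or]
    exact ⟨hne, (adj_ne h.1)⟩)
  have h3 := T.adj_iff a b hne
  have h4 := h.1
  have h5 := h'.1
  tauto

/-- Extending a chain from `w` to its twin `v` keeps the arc from `a`, since `a` sees `w` and `v`
alike. In particular the chains contain no cycle, so ranks along them make sense. -/
theorem TwinArc.adj_of_transGen {a b : V} (h : Relation.TransGen T.TwinArc a b) : T.Adj a b := by
  induction h with
  | single h => exact h.1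
  | @tail w v h1 h2 ih =>
    have hv : a ≠ v := by
      rintro rfl
      exact adj_asymm ih h2.1
    exact (h2.2.1.1 w (by simp) v (by simp) a (by
      simp only [mem_insert_iff, mem_singleton_iff, not_or]
      exact ⟨adj_ne ih, hv⟩)).mp ih

variable (T) in
/-- The number of vertices that precede `v` in its chain of twins. -/
noncomputable def twinRank (v : V) : ℕ := {u | Relation.TransGen T.TwinArc u v}.ncard

theorem TwinArc.twinRank_succ [Finite V] {a b : V} (h : T.TwinArc a b) :
    T.twinRank b = T.twinRank a + 1 := by
  have : {u | Relation.TransGen T.TwinArc u b} = insert a {u | Relation.TransGen T.TwinArc u a} := by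
    ext u
    constructor
    · intro hu
      rcases Relation.TransGen.tail'_iff.mp hu with ⟨c, hc, hc'⟩
      obtain rfl := hc'.pred_unique h
      rcases Relation.reflTransGen_iff_eq_or_transGen.mp hc with h | h
      · exact Or.inl h.symm
      · exact Or.inr h
    · rintro (rfl | hu)
      · exact Relation.TransGen.single h
      · exact Relation.TransGen.tail hu h
  unfold twinRank
  rw [this, ncard_insert_of_notMem]
  intro ha
  exact T.irrefl _ (adj_of_transGen ha)

variable (T) in
/-- `X` meets every comodule, and the sets `M x`, for `x ∈ X`, are pairwise disjoint minimal
comodules with `x ∈ M x`. -/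
structure IsTransversal (X : Set V) (M : V → Set V) : Prop where
  mem : ∀ x ∈ X, x ∈ M x
  isMin : ∀ x ∈ X, T.IsMinComodule (M x)
  disjoint : ∀ x ∈ X, ∀ y ∈ X, x ≠ y → Disjoint (M x) (M y)
  hit : ∀ D, T.IsComodule D → ∃ x ∈ X, x ∈ D

variable (T) in
-- A minimal comodule that is not a twin pair is disjoint from all others and gets an arbitrary
-- representative. Of the twin pairs, only those whose head has odd rank are kept, represented by
-- the head. These are disjoint, and the heads still meet every twin pair.
theorem exists_isTransversal [Finite V] : ∃ X M, T.IsTransversal X M := by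
  classical
  let IsTwin : Set V → Prop := fun M => ∃ a b, T.TwinArc a b ∧ M = {a, b}
  choose rep hrep using fun (M : Set V) (h : T.IsMinComodule M) => h.prop.nonempty
  let Good : Set V → V → Prop := fun M x => ∃ h : T.IsMinComodule M, x ∈ M ∧
    ((¬ IsTwin M ∧ x = rep M h) ∨ ∃ a, T.TwinArc a x ∧ M = {a, x} ∧ Odd (T.twinRank x))
  have hgood : ∀ M x M' x', Good M x → Good M' x' → (M = M' ∧ x = x') ∨ Disjoint M M' := by
    rintro M x M' x' ⟨hM, hx, h⟩ ⟨hM', hx', h'⟩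
    by_cases hMM : M = M'
    · subst hMM
      left
      refine ⟨rfl, ?_⟩
      rcases h with ⟨h1, h2⟩ | ⟨a, h1, h2, h3⟩ <;> rcases h' with ⟨h1', h2'⟩ | ⟨a', h1', h2', h3'⟩
      · rw [h2, h2']
      · exact (h1 ⟨_, _, h1', h2'⟩).elim
      · exact (h1' ⟨_, _, h1, h2⟩).elim
      · rw [h2] at hx'
        rcases hx' with rfl | rfl
        · rw [h2'] at hx
          rcases hx with rfl | rfl
          · exact (adj_asymm h1.1 h1'.1).elim
          · rfl
        · rfl
    · by_contra hcon
      rw [not_or, not_disjoint_iff_nonempty_inter] at hcon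
      obtain ⟨n1, n2, a, b, c, e1, e2, hab, hbc⟩ := hM.overlap hM' hMM hcon.2
      have t1 : IsTwin M := by
        rcases adj_total (T := T) hab with h | h
        · exact ⟨a, b, ⟨h, e1 ▸ n1, e1 ▸ hM⟩, e1⟩
        · exact ⟨b, a, ⟨h, pair_comm a b ▸ e1 ▸ n1, pair_comm a b ▸ e1 ▸ hM⟩, pair_comm a b ▸ e1⟩
      have t2 : IsTwin M' := by
        rcases adj_total (T := T) hbc with h | h
        · exact ⟨b, c, ⟨h, e2 ▸ n2, e2 ▸ hM'⟩, e2⟩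
        · exact ⟨c, b, ⟨h, pair_comm b c ▸ e2 ▸ n2, pair_comm b c ▸ e2 ▸ hM'⟩, pair_comm b c ▸ e2⟩
      rcases h with ⟨h1, -⟩ | ⟨p, h1, h2, h3⟩
      · exact h1 t1
      rcases h' with ⟨h1', -⟩ | ⟨p', h1', h2', h3'⟩
      · exact h1' t2
      obtain ⟨z, hz, hz'⟩ := hcon.2
      rw [h2] at hz
      rw [h2'] at hz'
      have r1 := h1.twinRank_succ
      have r2 := h1'.twinRank_succ
      -- A common tail or a common head makes the pairs equal; if the head of one is the tail of the
      -- other, their heads have consecutive ranks, which cannot both be odd.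
      rcases hz with rfl | rfl <;> rcases hz' with rfl | rfl
      · obtain rfl := h1.succ_unique h1'
        exact hMM (h2.trans h2'.symm)
      · rw [r1] at h3
        rw [Nat.odd_add_one] at h3
        exact h3 h3'
      · rw [r2] at h3'
        rw [Nat.odd_add_one] at h3'
        exact h3' h3
      · obtain rfl := h1.pred_unique h1'
        exact hMM (h2.trans h2'.symm)
  -- Outside the transversal the value is the irrelevant default `∅`.
  have hM : ∀ x : V, ∃ M, (∃ M, Good M x) → Good M x := by
    intro x
    by_cases h : ∃ M, Good M x
    · exact ⟨h.choose, fun _ => h.choose_spec⟩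
    · exact ⟨∅, fun h' => (h h').elim⟩
  choose M hM using hM
  refine ⟨{x | ∃ M, Good M x}, M, fun x hx => (hM x hx).choose_spec.1, fun x hx => (hM x hx).choose, ?_, ?_⟩
  · intro x hx y hy hxy
    rcases hgood _ _ _ _ (hM x hx) (hM y hy) with h | h
    · exact (hxy h.2).elim
    · exact h
  · intro D hD
    obtain ⟨P, hPD, hP⟩ := hD.exists_min
    by_cases hT : IsTwin P
    · obtain ⟨a, b, hab, rfl⟩ := hT
      by_cases ho : Odd (T.twinRank b)
      · exact ⟨b, ⟨_, hP, by simp, Or.inr ⟨a, hab, rfl, ho⟩⟩, hPD (by simp)⟩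
      -- Now the tail `a` has odd, hence positive, rank, so it is itself the head of a selected
      -- pair.
      · rw [hab.twinRank_succ, Nat.odd_add_one, not_not] at ho
        have hne : {u | Relation.TransGen T.TwinArc u a}.Nonempty := by
          rw [← ncard_pos]
          exact ho.pos
        obtain ⟨u, hu⟩ := hne
        obtain ⟨p, -, hp⟩ := Relation.TransGen.tail'_iff.mp hu
        exact ⟨a, ⟨_, hp.2.2, by simp, Or.inr ⟨p, hp, rfl, ho⟩⟩, hPD (by simp)⟩
    · exact ⟨rep P hP, ⟨P, hP, hrep P hP, Or.inl ⟨hT, rfl⟩⟩, hPD (hrep P hP)⟩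

end Transversal

/-! ### Reversing the arcs of a pairing; pairings that cover the most comodules -/

section Flip

variable {V : Type*} (T : Tournament V)

/-- The tournament obtained by reversing the arcs between `x` and `σ x`, for an involution `σ`. -/
def flip (σ : Equiv.Perm V) (hσ : Function.Involutive σ) : Tournament V where
  Adj x y := (σ x = y ∧ T.Adj y x) ∨ (σ x ≠ y ∧ T.Adj x y)
  irrefl x := by
    have := T.irrefl x
    tauto
  adj_iff x y hxy := by
    have h := T.adj_iff x y hxy
    have h' : σ x = y ↔ σ y = x :=
      ⟨fun h => by rw [← h, hσ], fun h => by rw [← h, hσ]⟩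
    tauto

variable {T}

theorem flip_adj_of_ne {σ : Equiv.Perm V} {hσ : Function.Involutive σ} {x y : V} (h : σ x ≠ y) :
    (T.flip σ hσ).Adj x y ↔ T.Adj x y := by
  simp [flip, h]

theorem flip_adj_of_eq {σ : Equiv.Perm V} {hσ : Function.Involutive σ} {x y : V} (h : σ x = y) :
    (T.flip σ hσ).Adj x y ↔ T.Adj y x := by
  simp [flip, h]

/-- A nontrivial module of the flipped tournament that is invariant under the involution. -/
theorem IsNontrivialModule.of_flip {σ : Equiv.Perm V} {hσ : Function.Involutive σ} {K : Set V}
    (hK : (T.flip σ hσ).IsNontrivialModule K) (h : ∀ x ∈ K, σ x ∈ K) :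
    T.IsNontrivialModule K := by
  refine ⟨fun x hx y hy v hv => ?_, hK.2⟩
  have hv' : σ v ∉ K := by
    intro h'
    have := h _ h'
    rw [hσ] at this
    exact hv this
  have := hK.1 x hx y hy v hv
  rwa [flip_adj_of_ne (by rintro rfl; exact hv' hx),
    flip_adj_of_ne (by rintro rfl; exact hv' hy)] at this

variable (T) in
/-- The arcs of `T` that are reversed in `T'`. -/
def reversedArcs (T' : Tournament V) : Set (V × V) := {a | T.Adj a.1 a.2 ∧ T'.Adj a.2 a.1}

theorem reversedArcs_subset (T T' T'' : Tournament V) :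
    T.reversedArcs T'' ⊆ T.reversedArcs T' ∪ T'.reversedArcs T'' := by
  rintro ⟨a, b⟩ ⟨h1, h2⟩
  rcases adj_total (T := T') (adj_ne h1) with h | h
  · exact Or.inr ⟨h, h2⟩
  · exact Or.inl ⟨h1, h⟩

theorem ncard_reversedArcs_le [Finite V] (T T' T'' : Tournament V) :
    (T.reversedArcs T'').ncard ≤ (T.reversedArcs T').ncard + (T'.reversedArcs T'').ncard :=
  (ncard_le_ncard (reversedArcs_subset T T' T'')).trans (ncard_union_le _ _)

theorem ext_adj {T T' : Tournament V} (h : ∀ x y, T.Adj x y ↔ T'.Adj x y) : T = T' := by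
  obtain ⟨⟨A⟩, _, _⟩ := T
  obtain ⟨⟨A'⟩, _, _⟩ := T'
  have : A = A' := by
    funext x y
    exact propext (h x y)
  subst this
  rfl

theorem inv_reversedArcs (T T' : Tournament V) (h : T.reversedArcs T' ⊆ T.arcs) :
    T.inv (T.reversedArcs T') h = T' := by
  apply ext_adj
  intro x y
  change ((x, y) ∈ (T.arcs \ T.reversedArcs T') ∪ Prod.swap ⁻¹' T.reversedArcs T') ↔ _
  by_cases hxy : x = y
  · subst hxy
    have h1 := T.irrefl x
    have h2 := T'.irrefl x
    simp only [reversedArcs, arcs, mem_union, mem_sdiff, mem_ofPred_eq, mem_preimage,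
      Prod.swap_prod_mk]
    tauto
  · have h1 := T.adj_iff x y hxy
    have h2 := T'.adj_iff x y hxy
    simp only [reversedArcs, arcs, mem_union, mem_sdiff, mem_ofPred_eq, mem_preimage,
      Prod.swap_prod_mk]
    tauto

theorem exists_inv_isIndecomposable [Finite V] {T' : Tournament V} (h : T'.IsIndecomposable) :
    ∃ (B : Finset (V × V)) (hB : (B : Set (V × V)) ⊆ T.arcs),
      B.card = (T.reversedArcs T').ncard ∧ (T.inv B hB).IsIndecomposable := by
  have hfin := (T.reversedArcs T').toFinite
  have hco : (hfin.toFinset : Set (V × V)) = T.reversedArcs T' := hfin.coe_toFinset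
  have hsub : T.reversedArcs T' ⊆ T.arcs := fun a ha => ha.1
  refine ⟨hfin.toFinset, hco.symm ▸ hsub, (ncard_eq_toFinset_card _ hfin).symm, ?_⟩
  have : T.inv (hfin.toFinset : Set (V × V)) (hco.symm ▸ hsub) = T' := by
    have key : ∀ (B : Set (V × V)) (hB : B ⊆ T.arcs), B = T.reversedArcs T' → T.inv B hB = T' := by
      rintro B hB rfl
      exact inv_reversedArcs T T' hB
    exact key _ _ hco
  rw [this]
  exact h

theorem decompIndex_le [Finite V] {T' : Tournament V} (h : T'.IsIndecomposable) :
    T.decompIndex ≤ (T.reversedArcs T').ncard :=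
  Nat.sInf_le (exists_inv_isIndecomposable h)

/-- `σ` is an involution whose set of non-fixed points is `Y`. -/
def IsPairing (σ : Equiv.Perm V) (Y : Set V) : Prop :=
  Function.Involutive σ ∧ ∀ x, σ x ≠ x ↔ x ∈ Y

theorem IsPairing.apply_mem {σ : Equiv.Perm V} {Y : Set V} (h : IsPairing σ Y) {x : V}
    (hx : x ∈ Y) : σ x ∈ Y := by
  rw [← h.2, h.1]
  exact ((h.2 x).mpr hx).symm

theorem IsPairing.apply_eq {σ : Equiv.Perm V} {Y : Set V} (h : IsPairing σ Y) {x : V}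
    (hx : x ∉ Y) : σ x = x := by
  by_contra h'
  exact hx ((h.2 x).mp h')

/-- The tails and the heads of the reversed arcs are disjoint subsets of `Y`, each as numerous as
those arcs. -/
theorem IsPairing.ncard_reversedArcs [Finite V] {σ : Equiv.Perm V} {Y : Set V}
    (h : IsPairing σ Y) : 2 * (T.reversedArcs (T.flip σ h.1)).ncard ≤ Y.ncard := by
  have hσ : ∀ a ∈ T.reversedArcs (T.flip σ h.1), σ a.1 = a.2 := by
    rintro ⟨a, b⟩ ⟨h1, h2⟩
    by_contra hne
    rw [flip_adj_of_ne] at h2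
    · exact adj_asymm h1 h2
    · intro h3
      apply hne
      rw [← h3, h.1]
  have e1 : (Prod.fst '' T.reversedArcs (T.flip σ h.1)).ncard =
      (T.reversedArcs (T.flip σ h.1)).ncard := by
    apply InjOn.ncard_image
    intro a ha b hb hab
    have hab' : a.1 = b.1 := hab
    exact Prod.ext hab' (by rw [← hσ a ha, ← hσ b hb, hab'])
  have e2 : (Prod.snd '' T.reversedArcs (T.flip σ h.1)).ncard =
      (T.reversedArcs (T.flip σ h.1)).ncard := by
    apply InjOn.ncard_image
    intro a ha b hb hab
    have hab' : a.2 = b.2 := hab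
    exact Prod.ext (σ.injective (by rw [hσ a ha, hσ b hb, hab'])) hab'
  have hd : Disjoint (Prod.fst '' T.reversedArcs (T.flip σ h.1))
      (Prod.snd '' T.reversedArcs (T.flip σ h.1)) := by
    rw [disjoint_left]
    rintro _ ⟨a, ha, rfl⟩ ⟨b, hb, hab⟩
    have h1 := hσ a ha
    have h2 := hσ b hb
    have h3 : b.1 = a.2 := by rw [← h1, ← hab, ← h2, h.1]
    have h4 := ha.1
    have h5 := hb.1
    rw [h3, hab] at h5
    exact adj_asymm h4 h5
  have hsub : Prod.fst '' T.reversedArcs (T.flip σ h.1) ∪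
      Prod.snd '' T.reversedArcs (T.flip σ h.1) ⊆ Y := by
    rintro _ (⟨a, ha, rfl⟩ | ⟨a, ha, rfl⟩)
    · rw [← h.2, hσ a ha]
      exact (adj_ne ha.1).symm
    · rw [← h.2, ← hσ a ha, h.1, hσ a ha]
      exact adj_ne ha.1
  have := ncard_le_ncard hsub
  rw [ncard_union_eq hd, e1, e2] at this
  omega

theorem exists_isPairing [Finite V] (n : ℕ) :
    ∀ Y : Set V, Y.ncard = 2 * n → ∃ σ, IsPairing σ Y := by
  classical
  induction n with
  | zero =>
    intro Y hY
    rw [mul_zero, ncard_eq_zero] at hY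
    subst hY
    exact ⟨1, fun x => rfl, fun x => by simp⟩
  | succ n ih =>
    intro Y hY
    obtain ⟨a, ha⟩ : Y.Nonempty := by rw [← ncard_pos]; omega
    have h1 := ncard_sdiff_singleton_of_mem ha
    obtain ⟨b, hb⟩ : (Y \ {a}).Nonempty := by rw [← ncard_pos]; omega
    have h2 := ncard_sdiff_singleton_of_mem hb
    obtain ⟨σ, hσ, hs⟩ := ih ((Y \ {a}) \ {b}) (by omega)
    have hba : b ≠ a := hb.2
    have fa : σ a = a := by
      by_contra h
      exact ((hs a).mp h).1.2 rfl
    have fb : σ b = b := by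
      by_contra h
      exact ((hs b).mp h).2 rfl
    have key : ∀ x, x ≠ a → x ≠ b → (Equiv.swap a b * σ) x = σ x := by
      intro x hxa hxb
      rw [Equiv.Perm.mul_apply, Equiv.swap_apply_of_ne_of_ne]
      · rw [← fa]; exact fun h => hxa (σ.injective h)
      · rw [← fb]; exact fun h => hxb (σ.injective h)
    have ka : (Equiv.swap a b * σ) a = b := by simp [fa]
    have kb : (Equiv.swap a b * σ) b = a := by simp [fb]
    refine ⟨Equiv.swap a b * σ, ?_, ?_⟩
    · intro x
      by_cases hxa : x = a
      · rw [hxa, ka, kb]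
      by_cases hxb : x = b
      · rw [hxb, kb, ka]
      rw [key x hxa hxb, key, hσ]
      · rw [← fa]; exact fun h => hxa (σ.injective h)
      · rw [← fb]; exact fun h => hxb (σ.injective h)
    · intro x
      by_cases hxa : x = a
      · rw [hxa, ka]; exact ⟨fun _ => ha, fun _ => hba⟩
      by_cases hxb : x = b
      · rw [hxb, kb]; exact ⟨fun _ => hb.1, fun _ => hba.symm⟩
      rw [key x hxa hxb, hs]
      simp [hxa, hxb]

theorem isPairing_swap [DecidableEq V] {x y : V} (hxy : x ≠ y) :
    IsPairing (Equiv.swap x y) {x, y} := by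
  refine ⟨fun z => by simp, fun z => ?_⟩
  by_cases h1 : z = x
  · subst h1; simp [hxy.symm]
  by_cases h2 : z = y
  · subst h2; simp [hxy]
  simp [Equiv.swap_apply_of_ne_of_ne h1 h2, h1, h2]

/-- Three comodules cannot split four vertices into pairs in the three possible ways. -/
theorem IsComodule.not_three_splits {a b c d : V} {D E F : Set V} (hD : T.IsComodule D)
    (hE : T.IsComodule E) (hF : T.IsComodule F) (hab : a ∈ D ↔ b ∈ D) (hcd : c ∈ D ↔ d ∈ D)
    (hac' : ¬ (a ∈ D ↔ c ∈ D)) (hac : a ∈ E ↔ c ∈ E) (hbd : b ∈ E ↔ d ∈ E)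
    (hab' : ¬ (a ∈ E ↔ b ∈ E)) (had : a ∈ F ↔ d ∈ F) (hbc : b ∈ F ↔ c ∈ F)
    (hab'' : ¬ (a ∈ F ↔ b ∈ F)) : False := by
  -- Splitting a pair is insensitive to complementation, so each comodule is replaced by whichever
  -- side is a module.
  have conv : ∀ D : Set V, T.IsComodule D →
      ∃ P : V → Prop, (∀ x y, (P x ↔ P y) ↔ (x ∈ D ↔ y ∈ D)) ∧
        ∀ x y v, P x → P y → ¬ P v → (T.Adj v x ↔ T.Adj v y) := by
    rintro D (h | h)
    · exact ⟨fun x => x ∈ D, fun x y => Iff.rfl, fun x y v hx hy hv => h.1 x hx y hy v hv⟩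
    · exact ⟨fun x => x ∉ D, fun x y => not_iff_not, fun x y v hx hy hv => h.1 x hx y hy v hv⟩
  obtain ⟨P, hP, mP⟩ := conv D hD
  obtain ⟨Q, hQ, mQ⟩ := conv E hE
  obtain ⟨R, hR, mR⟩ := conv F hF
  have P1 := (hP a b).mpr hab
  have P2 := (hP c d).mpr hcd
  have P3 := mt (hP a c).mp hac'
  have Q1 := (hQ a c).mpr hac
  have Q2 := (hQ b d).mpr hbd
  have Q3 := mt (hQ a b).mp hab'
  have R1 := (hR a d).mpr had
  have R2 := (hR b c).mpr hbc
  have R3 := mt (hR a b).mp hab''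
  clear conv hab hcd hac' hac hbd hab' had hbc hab'' hD hE hF hP hQ hR
  have nab := T.adj_iff a b (by rintro rfl; grind)
  have nac := T.adj_iff a c (by rintro rfl; grind)
  have nad := T.adj_iff a d (by rintro rfl; grind)
  have nbc := T.adj_iff b c (by rintro rfl; grind)
  have nbd := T.adj_iff b d (by rintro rfl; grind)
  have ncd := T.adj_iff c d (by rintro rfl; grind)
  have p1 := mP a b c
  have p2 := mP a b d
  have p3 := mP c d a
  have p4 := mP c d b
  have q1 := mQ a c b
  have q2 := mQ a c d
  have q3 := mQ b d a
  have q4 := mQ b d c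
  have r1 := mR a d b
  have r2 := mR a d c
  have r3 := mR b c a
  have r4 := mR b c d
  clear mP mQ mR
  -- What remains is propositional: on which side `a` lies in each split, and the six arcs among the
  -- four vertices.
  by_cases hPa : P a <;> by_cases hQa : Q a <;> by_cases hRa : R a <;> grind

/-- A pairing `σ` covers `D` if it pairs some vertex of `D` with a vertex outside. -/
def Covers (σ : Equiv.Perm V) (D : Set V) : Prop := ∃ x ∈ D, σ x ∉ D

theorem Covers.compl {σ : Equiv.Perm V} (hσ : Function.Involutive σ) {D : Set V}
    (h : Covers σ D) : Covers σ Dᶜ := by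
  obtain ⟨x, hx, hx'⟩ := h
  exact ⟨σ x, hx', by rw [hσ]; exact fun h => h hx⟩

/-- Re-pairing `a, b` and `c, d` as `a, c` and `b, d`. -/
theorem IsPairing.exists_exchange {σ : Equiv.Perm V} {Y : Set V} (h : IsPairing σ Y) {a c : V}
    (ha : a ∈ Y) (hc : c ∈ Y) (hac : a ≠ c) (hbc : σ a ≠ c) :
    ∃ τ, IsPairing τ Y ∧ τ a = c ∧ τ (σ a) = σ c ∧
      ∀ x, x ≠ a → x ≠ c → x ≠ σ a → x ≠ σ c → τ x = σ x := by
  classical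
  have hb := h.apply_mem ha
  have hab : σ a ≠ a := (h.2 a).mpr ha
  have hcd : σ c ≠ c := (h.2 c).mpr hc
  have hbd : σ a ≠ σ c := fun h' => hac (σ.injective h')
  let s := Equiv.swap (σ a) c
  have hs : ∀ x, s (s x) = x := fun x => Equiv.swap_apply_self _ _ x
  have hsY : ∀ x, s x ∈ Y ↔ x ∈ Y := by
    intro x
    by_cases h1 : x = σ a
    · subst h1; simp [s, hb, hc]
    by_cases h2 : x = c
    · subst h2; simp [s, hb, hc]
    rw [show s x = x from Equiv.swap_apply_of_ne_of_ne h1 h2]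
  have hc' : σ c ≠ c := hcd
  have had : a ≠ σ c := by
    intro h'
    apply hbc
    rw [h', h.1]
  -- Conjugating by the transposition of `σ a` and `c` exchanges the partners.
  refine ⟨s * σ * s, ⟨?_, ?_⟩, ?_, ?_, ?_⟩
  · intro x
    simp only [Equiv.Perm.mul_apply, hs]
    rw [h.1, hs]
  · intro x
    rw [← hsY, ← h.2]
    simp only [Equiv.Perm.mul_apply]
    constructor
    · intro h1 h2
      rw [h2, hs] at h1
      exact h1 rfl
    · intro h1 h2
      apply h1
      rw [← hs (σ (s x)), h2]
  · simp only [Equiv.Perm.mul_apply]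
    rw [show s a = a from Equiv.swap_apply_of_ne_of_ne hab.symm hac]
    exact Equiv.swap_apply_left _ _
  · simp only [Equiv.Perm.mul_apply]
    rw [show s (σ a) = c from Equiv.swap_apply_left _ _]
    exact Equiv.swap_apply_of_ne_of_ne hbd.symm hcd
  · intro x h1 h2 h3 h4
    simp only [Equiv.Perm.mul_apply]
    rw [show s x = x from Equiv.swap_apply_of_ne_of_ne h3 h2]
    apply Equiv.swap_apply_of_ne_of_ne
    · exact fun h' => h1 (σ.injective h')
    · intro h'
      apply h4
      rw [← h', h.1]

variable (T) in
/-- There is a pairing of `Y` such that every comodule it does not cover contains `Y` or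
is disjoint from `Y`. -/
theorem exists_covering_pairing [Finite V] {Y : Set V} (hY : Even Y.ncard) :
    ∃ σ, IsPairing σ Y ∧
      ∀ D, T.IsComodule D → ¬ Covers σ D → (D ∩ Y).Nonempty → (Dᶜ ∩ Y).Nonempty → False := by
  obtain ⟨n, hn⟩ := hY
  obtain ⟨σ₀, hσ₀⟩ := exists_isPairing n Y (by omega)
  -- The pairing is chosen to cover as many comodules as possible.
  let f : Equiv.Perm V → ℕ := fun σ => {D | T.IsComodule D ∧ Covers σ D}.ncard
  obtain ⟨σ, hσ, hmax⟩ := (Set.toFinite {σ : Equiv.Perm V | IsPairing σ Y}).exists_maximalFor f _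
    ⟨σ₀, hσ₀⟩
  have hσ : IsPairing σ Y := hσ
  refine ⟨σ, hσ, ?_⟩
  rintro D hD hnc ⟨a, haD, haY⟩ ⟨c, hcD, hcY⟩
  have hbD : σ a ∈ D := by
    by_contra h
    exact hnc ⟨a, haD, h⟩
  have hdD : σ c ∉ D := by
    intro h
    exact hnc ⟨σ c, h, by rwa [hσ.1]⟩
  -- The exchange covers `D`, so by maximality it uncovers some `E`. Such an `E` joins the new
  -- partners and separates the old ones.
  have exch : ∀ c, c ∉ D → σ c ∉ D → c ∈ Y → ∃ E, T.IsComodule E ∧ (a ∈ E ↔ c ∈ E) ∧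
      (σ a ∈ E ↔ σ c ∈ E) ∧ ¬ (a ∈ E ↔ σ a ∈ E) := by
    intro c hcD hdD hcY
    obtain ⟨τ, hτ, hac, hbd, hx⟩ := hσ.exists_exchange haY hcY (by rintro rfl; exact hcD haD)
      (by rintro rfl; exact hcD hbD)
    have hnot : ¬ {E | T.IsComodule E ∧ Covers σ E} ⊆ {E | T.IsComodule E ∧ Covers τ E} := by
      intro hsub
      have hlt : f σ < f τ := by
        refine ncard_lt_ncard ((ssubset_iff_of_subset hsub).mpr ?_) (toFinite _)
        exact ⟨D, ⟨hD, a, haD, by rwa [hac]⟩, fun h => hnc h.2⟩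
      have := hmax hτ hlt.le
      omega
    rw [not_subset] at hnot
    obtain ⟨E, ⟨hE, z, hz, hz'⟩, hE'⟩ := hnot
    have hun : ∀ x, x ∈ E ↔ τ x ∈ E := by
      intro x
      constructor
      · intro h
        by_contra h'
        exact hE' ⟨hE, x, h, h'⟩
      · intro h
        by_contra h'
        exact hE' ⟨hE, τ x, h, by rwa [hτ.1]⟩
    have h1 : a ∈ E ↔ c ∈ E := by rw [← hac]; exact hun a
    have h2 : σ a ∈ E ↔ σ c ∈ E := by rw [← hbd]; exact hun (σ a)
    refine ⟨E, hE, h1, h2, fun h3 => hz' ?_⟩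
    have e1 := hσ.1 a
    have e2 := hσ.1 c
    by_cases z1 : z = a
    · subst z1; tauto
    by_cases z2 : z = c
    · subst z2; tauto
    by_cases z3 : z = σ a
    · rw [z3, e1]; rw [z3] at hz; tauto
    by_cases z4 : z = σ c
    · rw [z4, e2]; rw [z4] at hz; tauto
    rw [← hx z z1 z2 z3 z4, ← hun]
    exact hz
  -- Both exchanges, with `c` and with `σ c`, are needed: `D`, `E`, `F` then split `a, σ a, c, σ c`
  -- in all three ways.
  obtain ⟨E, hE, e1, e2, e3⟩ := exch c hcD hdD hcY
  obtain ⟨F, hF, f1, f2, f3⟩ := exch (σ c) hdD (by rwa [hσ.1]) (hσ.apply_mem hcY)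
  rw [hσ.1] at f2
  exact IsComodule.not_three_splits hD hE hF (a := a) (b := σ a) (c := c) (d := σ c)
    (by tauto) (by tauto) (by tauto) e1 e2 e3 f1 f2 f3

end Flip

/-! ### Local analysis of a new module that separates two partners -/

section Obstruction

variable {V : Type*} (T : Tournament V)

/-- No vertex of `S` other than `x` is distinguished from another one by `x`. -/
def IsExtremeIn (x : V) (S : Set V) : Prop :=
  ∀ u ∈ S, ∀ v ∈ S, u ≠ x → v ≠ x → (T.Adj x u ↔ T.Adj x v)

/-- `M` and `N` are modules, `M` is a pair containing `x`, and `M ∪ N` is a module. -/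
def ObstructedTwin (x : V) (M N : Set V) : Prop :=
  T.IsNontrivialModule M ∧ T.IsNontrivialModule N ∧ T.IsModule (M ∪ N) ∧ ∃ x', M = {x, x'}

/-- `M` is a module and a pair containing `x`, the complement of `N` is a module with source or
sink `x`, and `N` has an element besides `y`. -/
def ObstructedExtreme (x : V) (M : Set V) (y : V) (N : Set V) : Prop :=
  T.IsNontrivialModule M ∧ (∃ x', M = {x, x'}) ∧ T.IsNontrivialModule Nᶜ ∧ T.IsExtremeIn x Nᶜ ∧
    ∃ k ∈ N, k ≠ y

/-- `M` consists of a source or sink `x`, and both `N` and `M ∪ N` are modules. -/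
def ObstructedEnd (x : V) (M N : Set V) : Prop :=
  M = {x} ∧ T.IsNontrivialModule Mᶜ ∧ T.IsNontrivialModule N ∧ T.IsModule (M ∪ N)

/-- One of the configurations in which reversing the arc between `x` and `y` may create a
module. -/
def Obstructed (x : V) (M : Set V) (y : V) (N : Set V) : Prop :=
  T.ObstructedTwin x M N ∨ T.ObstructedExtreme x M y N ∨ T.ObstructedEnd x M N

variable {T}

/-- The data around one pair `x`, `y` crossing a module `K` of the flipped tournament. -/
structure Crossing (T : Tournament V) (σ : Equiv.Perm V) (hσ : Function.Involutive σ)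
    (x : V) (M : Set V) (y : V) (N : Set V) (K : Set V) : Prop where
  minM : T.IsMinComodule M
  minN : T.IsMinComodule N
  disj : ∀ u ∈ M, u ∉ N
  hx : x ∈ M
  hy : y ∈ N
  hxy : σ x = y
  fixM : ∀ u ∈ M, u ≠ x → σ u = u
  fixN : ∀ u ∈ N, u ≠ y → σ u = u
  mod : (T.flip σ hσ).IsModule K
  nontriv : K.Nontrivial
  hxK : x ∈ K
  hyK : y ∉ K

namespace Crossing

variable {σ : Equiv.Perm V} {hσ : Function.Involutive σ} {x y : V} {M N K : Set V}

theorem hyx (h : Crossing T σ hσ x M y N K) : σ y = x := by rw [← h.hxy, hσ]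

theorem ne (h : Crossing T σ hσ x M y N K) : x ≠ y := by
  rintro rfl
  exact h.hyK h.hxK

/-- After the flip `y` sees `k` and `x` alike, but only its arc with `x` was reversed. So in `T` the
vertex `y` distinguishes `x` from every other point of `K`, the source of most contradictions below.
-/
theorem adj_iff (h : Crossing T σ hσ x M y N K) {k : V} (hk : k ∈ K) (hkx : k ≠ x) :
    T.Adj y k ↔ T.Adj x y := by
  have := h.mod k hk x h.hxK y h.hyK
  rwa [flip_adj_of_ne (by rw [h.hyx]; exact hkx.symm), flip_adj_of_eq h.hyx] at this

theorem adj_iff_of_fix (h : Crossing T σ hσ x M y N K) {k v : V} (hk : k ∈ K) (hv : v ∉ K)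
    (hvy : v ≠ y) (hkv : σ k = k ∨ σ v = v) :
    T.Adj v k ↔ T.Adj v x := by
  have := h.mod k hk x h.hxK v hv
  rwa [flip_adj_of_ne, flip_adj_of_ne] at this
  · intro h'
    apply hvy
    rw [← h.hxy, ← h', hσ]
  · intro h'
    rcases hkv with h1 | h1
    · apply hv
      have : v = σ k := by rw [← h', hσ]
      rw [this, h1]
      exact hk
    · rw [h1] at h'
      exact hv (h' ▸ hk)

/-- By `adj_iff`, the module `M` can meet `K` only in `x`. Comparison with a point of `K` outside
`M` shows that `x` does not split `M \ {x}`, which is therefore a module, and a single point by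
minimality. -/
theorem fst_module (h : Crossing T σ hσ x M y N K) (hM : T.IsNontrivialModule M) :
    ∃ x', x' ≠ x ∧ M = {x, x'} ∧ x' ∉ K := by
  have hyM : y ∉ M := fun h' => h.disj y h' h.hy
  have h1 : ∀ k ∈ K, k ∈ M → k = x := by
    intro k hk hkM
    by_contra hkx
    have a1 := h.adj_iff hk hkx
    have a2 := hM.1 k hkM x h.hx y hyM
    have a3 := T.adj_iff x y h.ne
    grind only
  obtain ⟨z, hz, hzx⟩ := h.nontriv.exists_ne x
  have hzM : z ∉ M := fun h' => hzx (h1 z hz h')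
  have hmod : T.IsModule (M \ {x}) := by
    rintro u ⟨hu, hux⟩ u' ⟨hu', hux'⟩ v hv
    by_cases hvM : v ∈ M
    · have hvx : v = x := by_contra fun h' => hv ⟨hvM, h'⟩
      subst hvx
      have b1 := h.adj_iff_of_fix hz (v := u) (fun h' => hux (h1 u h' hu))
        (by rintro rfl; exact hyM hu) (Or.inr (h.fixM u hu hux))
      have b2 := h.adj_iff_of_fix hz (v := u') (fun h' => hux' (h1 u' h' hu'))
        (by rintro rfl; exact hyM hu') (Or.inr (h.fixM u' hu' hux'))
      have b3 := hM.1 u hu u' hu' z hzM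
      have c1 := T.adj_iff u z (by rintro rfl; exact hzM hu)
      have c2 := T.adj_iff u' z (by rintro rfl; exact hzM hu')
      have c3 := T.adj_iff u v hux
      have c4 := T.adj_iff u' v hux'
      grind only
    · exact hM.1 u hu u' hu' v hvM
  have hss := h.minM.subsingleton_of_isModule hmod sdiff_subset
    (by intro h'; have := h.hx; rw [← h'] at this; exact this.2 rfl)
  obtain ⟨x', hx', hxx'⟩ := hM.2.1.exists_ne x
  refine ⟨x', hxx', ?_, fun h' => hxx' (h1 x' h' hx')⟩
  ext u
  constructor
  · intro hu
    by_cases hux : u = x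
    · exact Or.inl hux
    · exact Or.inr (hss ⟨hu, hux⟩ ⟨hx', hxx'⟩)
  · rintro (rfl | rfl)
    · exact h.hx
    · exact hx'

/-- If `K` leaves `M`, then `K ∪ Mᶜ` is a module; were its complement `M \ K` nonempty, it would be
a comodule strictly inside `M`. -/
theorem fst_compl (h : Crossing T σ hσ x M y N K) (hM : T.IsNontrivialModule Mᶜ) : M ⊆ K := by
  have hyM : y ∉ M := fun h' => h.disj y h' h.hy
  by_cases hz : ∃ z ∈ K, z ∉ M
  · obtain ⟨z, hz, hzM⟩ := hz
    by_contra hsub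
    rw [not_subset] at hsub
    obtain ⟨u, hu, huK⟩ := hsub
    have hmod : T.IsModule (K ∪ Mᶜ) := by
      have key : ∀ a ∈ K ∪ Mᶜ, ∀ v ∉ K ∪ Mᶜ, (T.Adj v a ↔ T.Adj v x) := by
        intro a ha v hv
        simp only [mem_union, mem_compl_iff, not_or, not_not] at hv
        have hvx : v ≠ x := by rintro rfl; exact hv.1 h.hxK
        have hvy : v ≠ y := by rintro rfl; exact hyM hv.2
        have hK : ∀ a ∈ K, (T.Adj v a ↔ T.Adj v x) := fun a ha =>
          h.adj_iff_of_fix ha hv.1 hvy (Or.inr (h.fixM v hv.2 hvx))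
        rcases ha with ha | ha
        · exact hK a ha
        · rw [← hK z hz]
          exact hM.1 a ha z hzM v (fun h' => h' hv.2)
      intro a ha b hb v hv
      rw [key a ha v hv, key b hb v hv]
    have hcomp : (K ∪ Mᶜ)ᶜ = M \ K := by ext; simp; tauto
    have hco : T.IsComodule (M \ K) := by
      rw [← hcomp]
      refine IsComodule.compl (Or.inl ⟨hmod, hM.2.1.mono subset_union_right, ?_⟩)
      intro h'
      have : u ∈ (K ∪ Mᶜ) := h' ▸ mem_univ u
      rcases this with h | h
      · exact huK h
      · exact h hu
    have := h.minM.eq_of_subset hco sdiff_subset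
    have hx := h.hx
    rw [← this] at hx
    exact hx.2 h.hxK
  -- If `K ⊆ M`, a second point `w` of `Mᶜ` sees `k` and `x` alike. As `k` and `x` do not
  -- distinguish `w` from `y`, so does `y`, against `adj_iff`.
  · exfalso
    push Not at hz
    obtain ⟨k, hk, hkx⟩ := h.nontriv.exists_ne x
    obtain ⟨w, hw, hwy⟩ := hM.2.1.exists_ne y
    have hwM : w ∉ M := hw
    have a1 := h.adj_iff_of_fix hk (v := w) (fun h' => hwM (hz w h')) hwy
      (Or.inl (h.fixM k (hz k hk) hkx))
    have a2 := h.adj_iff hk hkx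
    have a3 := hM.1 y hyM w hw k (fun h' => h' (hz k hk))
    have a4 := hM.1 y hyM w hw x (fun h' => h' h.hx)
    have b1 := T.adj_iff x y h.ne
    have b2 := T.adj_iff x w (by rintro rfl; exact hwM h.hx)
    have b3 := T.adj_iff k w (by rintro rfl; exact hwM (hz k hk))
    have b4 := T.adj_iff k y (by rintro rfl; exact hyM (hz k hk))
    grind only

/-- `K ∩ N` is a module missing `y`, so it has at most one point. Were it empty, a point of `N`
other than `y` would see `K` uniformly and, `N` being a module, so would `y`. -/
theorem snd_module (h : Crossing T σ hσ x M y N K) (hN : T.IsNontrivialModule N) :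
    ∃ z ∈ N, z ∈ K ∧ z ≠ y ∧ ∀ u ∈ N, u ∈ K → u = z := by
  have hxN : x ∉ N := h.disj x h.hx
  have hmod : T.IsModule (K ∩ N) := by
    rintro a ⟨ha, haN⟩ b ⟨hb, hbN⟩ v hv
    by_cases hvN : v ∈ N
    · have hvK : v ∉ K := fun h' => hv ⟨h', hvN⟩
      have hax : a ≠ x := by rintro rfl; exact hxN haN
      have hbx : b ≠ x := by rintro rfl; exact hxN hbN
      by_cases hvy : v = y
      · subst hvy
        rw [h.adj_iff ha hax, h.adj_iff hb hbx]
      · rw [h.adj_iff_of_fix ha hvK hvy (Or.inr (h.fixN v hvN hvy)),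
          h.adj_iff_of_fix hb hvK hvy (Or.inr (h.fixN v hvN hvy))]
    · exact hN.1 a haN b hbN v hvN
  have hss := h.minN.subsingleton_of_isModule hmod inter_subset_right
    (by intro h'; have := h.hy; rw [← h'] at this; exact h.hyK this.1)
  have hne : (K ∩ N).Nonempty := by
    by_contra hemp
    rw [not_nonempty_iff_eq_empty] at hemp
    have hKN : ∀ k ∈ K, k ∉ N := by
      intro k hk hkN
      have : k ∈ K ∩ N := ⟨hk, hkN⟩
      rw [hemp] at this
      exact this
    obtain ⟨u, hu, huy⟩ := hN.2.1.exists_ne y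
    obtain ⟨k, hk, hkx⟩ := h.nontriv.exists_ne x
    have a1 := h.adj_iff hk hkx
    have a2 := h.adj_iff_of_fix hk (v := u) (fun h' => hKN u h' hu) huy
      (Or.inr (h.fixN u hu huy))
    have a3 := hN.1 u hu y h.hy k (hKN k hk)
    have a4 := hN.1 u hu y h.hy x hxN
    have b1 := T.adj_iff x y h.ne
    have b2 := T.adj_iff x u (by rintro rfl; exact hxN hu)
    have b3 := T.adj_iff k u (by rintro rfl; exact hKN k hk hu)
    have b4 := T.adj_iff k y (by rintro rfl; exact hKN k hk h.hy)
    grind only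
  obtain ⟨z, hz, hzN⟩ := hne
  exact ⟨z, hzN, hz, by rintro rfl; exact h.hyK hz, fun u hu hu' => hss ⟨hu', hu⟩ ⟨hz, hzN⟩⟩

/-- By `adj_iff`, all of `K` but `x` lies in `N`; it is a module missing `y`, hence one point `k`.
The vertices outside `N` see `x` as they see `k`, and `k` sees `Nᶜ` uniformly, so `x` is extreme
there. -/
theorem snd_compl (h : Crossing T σ hσ x M y N K) (hN : T.IsNontrivialModule Nᶜ) :
    ∃ k ∈ N, k ≠ y ∧ K = {x, k} ∧ T.IsExtremeIn x Nᶜ ∧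
      ∀ w ∉ N, w ≠ x → (T.Adj w k ↔ T.Adj w x) := by
  have hxN : x ∉ N := h.disj x h.hx
  have hKN : ∀ k ∈ K, k ≠ x → k ∈ N := by
    intro k hk hkx
    by_contra hkN
    have a1 := h.adj_iff hk hkx
    have a2 := hN.1 k hkN x hxN y (fun h' => h' h.hy)
    have a3 := T.adj_iff x y h.ne
    grind only
  have hout : ∀ w ∉ N, w ≠ x → ∀ k ∈ K, k ≠ x → (T.Adj w k ↔ T.Adj w x) := by
    intro w hw hwx k hk hkx
    have hky : k ≠ y := by rintro rfl; exact h.hyK hk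
    exact h.adj_iff_of_fix hk (fun h' => hw (hKN w h' hwx)) (by rintro rfl; exact hw h.hy)
      (Or.inl (h.fixN k (hKN k hk hkx) hky))
  obtain ⟨w, hw, hwx⟩ := hN.2.1.exists_ne x
  have hwN : w ∉ N := hw
  have hmod : T.IsModule (K \ {x}) := by
    rintro a ⟨ha, hax⟩ b ⟨hb, hbx⟩ v hv
    have hay : a ≠ y := by rintro rfl; exact h.hyK ha
    have hby : b ≠ y := by rintro rfl; exact h.hyK hb
    by_cases hvx : v = x
    · subst hvx
      have a1 := hout w hw hwx a ha hax
      have a2 := hout w hw hwx b hb hbx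
      have a3 := hN.1 v hxN w hw a (fun h' => h' (hKN a ha hax))
      have a4 := hN.1 v hxN w hw b (fun h' => h' (hKN b hb hbx))
      have b1 := T.adj_iff a v hax
      have b2 := T.adj_iff b v hbx
      have b3 := T.adj_iff a w (by rintro rfl; exact hwN (hKN a ha hax))
      have b4 := T.adj_iff b w (by rintro rfl; exact hwN (hKN b hb hbx))
      grind only
    · have hvK : v ∉ K := fun h' => hv ⟨h', hvx⟩
      by_cases hvy : v = y
      · subst hvy
        rw [h.adj_iff ha hax, h.adj_iff hb hbx]
      · rw [h.adj_iff_of_fix ha hvK hvy (Or.inl (h.fixN a (hKN a ha hax) hay)),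
          h.adj_iff_of_fix hb hvK hvy (Or.inl (h.fixN b (hKN b hb hbx) hby))]
  have hss := h.minN.subsingleton_of_isModule hmod (fun a ha => hKN a ha.1 ha.2)
    (by intro h'; have := h.hy; rw [← h'] at this; exact h.hyK this.1)
  obtain ⟨k, hk, hkx⟩ := h.nontriv.exists_ne x
  have hkN := hKN k hk hkx
  refine ⟨k, hkN, by rintro rfl; exact h.hyK hk, ?_, ?_, fun w hw hwx => hout w hw hwx k hk hkx⟩
  · ext u
    constructor
    · intro hu
      by_cases hux : u = x
      · exact Or.inl hux
      · exact Or.inr (hss ⟨hu, hux⟩ ⟨hk, hkx⟩)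
    · rintro (rfl | rfl)
      · exact h.hxK
      · exact hk
  · have key : ∀ u ∈ Nᶜ, u ≠ x → (T.Adj x u ↔ T.Adj k x) := by
      intro u hu hux
      have huN : u ∉ N := hu
      have a1 := hout u hu hux k hk hkx
      have a2 := hN.1 u hu x hxN k (fun h' => h' hkN)
      have b1 := T.adj_iff u x hux
      have b2 := T.adj_iff k x hkx
      have b3 := T.adj_iff k u (by rintro rfl; exact huN hkN)
      grind only
    intro u hu v hv hux hvx
    rw [key u hu hux, key v hv hvx]

theorem obstructed (h : Crossing T σ hσ x M y N K) :
    T.Obstructed x M y N ∨ T.Obstructed y N x M := by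
  have hyM : y ∉ M := fun h' => h.disj y h' h.hy
  have hxN : x ∉ N := h.disj x h.hx
  rcases h.minM.prop with hM | hM <;> rcases h.minN.prop with hN | hN
  · obtain ⟨x', hx'x, rfl, hx'K⟩ := h.fst_module hM
    obtain ⟨z, hzN, hzK, hzy, hz⟩ := h.snd_module hN
    refine Or.inl (Or.inl ⟨hM, hN, ?_, x', rfl⟩)
    have hx'N : x' ∉ N := h.disj x' (by simp)
    have hzx : z ≠ x := by rintro rfl; exact hxN hzN
    have key : ∀ v ∉ ({x, x'} : Set V) ∪ N, (T.Adj v x ↔ T.Adj v z) := by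
      intro v hv
      rw [mem_union, not_or] at hv
      obtain ⟨hv, hvN⟩ := hv
      have hvx : v ≠ x := by rintro rfl; simp at hv
      have hvx' : v ≠ x' := by rintro rfl; simp at hv
      have hvy : v ≠ y := by rintro rfl; exact hvN h.hy
      have hvz : v ≠ z := by rintro rfl; exact hvN hzN
      by_cases hvK : v ∈ K
      · have fx' := h.fixM x' (by simp) hx'x
        have hx'y : x' ≠ y := by rintro rfl; exact hx'N h.hy
        have a1 := h.adj_iff hvK hvx
        have a2 := hN.1 y h.hy z hzN v hvN
        have a3 := h.adj_iff_of_fix hvK hx'K hx'y (Or.inr fx')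
        have a4 := h.adj_iff_of_fix hzK hx'K hx'y (Or.inr fx')
        have a5 := hM.1 x (by simp) x' (by simp) z (by
          simp only [mem_insert_iff, mem_singleton_iff, not_or]
          exact ⟨hzx, by rintro rfl; exact hx'N hzN⟩)
        have a6 := hN.1 y h.hy z hzN x hxN
        have a7 := hM.1 x (by simp) x' (by simp) v hv
        have b1 := T.adj_iff v y hvy
        have b2 := T.adj_iff v x' hvx'
        have b3 := T.adj_iff z x' (by rintro rfl; exact hx'N hzN)
        have b4 := T.adj_iff x z hzx.symm
        grind only
      · exact (h.adj_iff_of_fix hzK hvK hvy (Or.inl (h.fixN z hzN hzy))).symm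
    have key' : ∀ a ∈ ({x, x'} : Set V) ∪ N, ∀ v ∉ ({x, x'} : Set V) ∪ N,
        (T.Adj v a ↔ T.Adj v x) := by
      intro a ha v hv
      rcases ha with ha | ha
      · exact hM.1 a ha x (by simp) v (fun h' => hv (Or.inl h'))
      · rw [key v hv]
        exact hN.1 a ha z hzN v (fun h' => hv (Or.inr h'))
    intro a ha b hb v hv
    rw [key' a ha v hv, key' b hb v hv]
  · obtain ⟨x', hx'x, rfl, hx'K⟩ := h.fst_module hM
    obtain ⟨k, hkN, hky, -, hext, -⟩ := h.snd_compl hN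
    exact Or.inl (Or.inr (Or.inl ⟨hM, ⟨x', rfl⟩, hN, hext, k, hkN, hky⟩))
  · have hMK := h.fst_compl hM
    obtain ⟨z, hzN, hzK, hzy, hz⟩ := h.snd_module hN
    by_cases hu : ∃ u ∈ M, u ≠ x
    · obtain ⟨u, hu, hux⟩ := hu
      -- A missing `w` would see `u` and `x` alike, and `y` with it since `Mᶜ` is a module. With
      -- only `y` outside `K`, the module `N` is the pair `{y, z}` and `y` is extreme in `Mᶜ`.
      have hK : ∀ w, w ≠ y → w ∈ K := by
        intro w hwy
        by_contra hwK
        have hwM : w ∉ M := fun h' => hwK (hMK h')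
        have a1 := h.adj_iff_of_fix (hMK hu) hwK hwy (Or.inl (h.fixM u hu hux))
        have a2 := h.adj_iff (hMK hu) hux
        have a3 := hM.1 w hwM y hyM u (fun h' => h' hu)
        have a4 := hM.1 w hwM y hyM x (fun h' => h' h.hx)
        have b1 := T.adj_iff x y h.ne
        have b2 := T.adj_iff x w (by rintro rfl; exact hwM h.hx)
        have b3 := T.adj_iff u w (by rintro rfl; exact hwM hu)
        have b4 := T.adj_iff u y (by rintro rfl; exact hyM hu)
        grind only
      refine Or.inr (Or.inr (Or.inl ⟨hN, ⟨z, ?_⟩, hM, ?_, u, hu, hux⟩))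
      · ext w
        constructor
        · intro hw
          by_cases hwy : w = y
          · exact Or.inl hwy
          · exact Or.inr (hz w hw (hK w hwy))
        · rintro (rfl | rfl)
          · exact h.hy
          · exact hzN
      · intro a ha b hb hay hby
        rw [h.adj_iff (hK a hay) (by rintro rfl; exact ha h.hx),
          h.adj_iff (hK b hby) (by rintro rfl; exact hb h.hx)]
    · push Not at hu
      have hMx : M = {x} := by
        ext w
        exact ⟨hu w, by rintro rfl; exact h.hx⟩
      refine Or.inl (Or.inr (Or.inr ⟨hMx, hM, hN, ?_⟩))
      subst hMx
      have key : ∀ a ∈ N, ∀ v ∉ ({x} : Set V) ∪ N, (T.Adj v a ↔ T.Adj v x) := by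
        intro a ha v hv
        rw [mem_union, not_or] at hv
        obtain ⟨hv, hvN⟩ := hv
        have hvx : v ≠ x := hv
        have hvy : v ≠ y := by rintro rfl; exact hvN h.hy
        rw [hN.1 a ha z hzN v hvN]
        by_cases hvK : v ∈ K
        · have a1 := h.adj_iff hvK hvx
          have a2 := hN.1 y h.hy z hzN v hvN
          have a3 := hM.1 y (by exact hyM) v hv x (fun h' => h' rfl)
          have b1 := T.adj_iff v y hvy
          have b2 := T.adj_iff v x hvx
          grind only
        · exact h.adj_iff_of_fix hzK hvK hvy (Or.inl (h.fixN z hzN hzy))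
      have key' : ∀ a ∈ ({x} : Set V) ∪ N, ∀ v ∉ ({x} : Set V) ∪ N,
          (T.Adj v a ↔ T.Adj v x) := by
        intro a ha v hv
        rcases ha with rfl | ha
        · exact Iff.rfl
        · exact key a ha v hv
      intro a ha b hb v hv
      rw [key' a ha v hv, key' b hb v hv]
  -- Two complements: each of `w`, `k`, `x` would see the other two alike, which no three vertices
  -- of a tournament allow.
  · exfalso
    have hMK := h.fst_compl hM
    obtain ⟨k, hkN, hky, hK, hext, hw⟩ := h.snd_compl hN
    have hkM : k ∉ M := fun h' => h.disj k h' hkN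
    obtain ⟨w, hwN, hwx⟩ := hN.2.1.exists_ne x
    have hwN' : w ∉ N := hwN
    have hwM : w ∉ M := by
      intro h'
      have := hMK h'
      rw [hK] at this
      rcases this with h1 | h1
      · exact hwx h1
      · exact hwN' (h1 ▸ hkN)
    have hkx : k ≠ x := by rintro rfl; exact hxN hkN
    have a1 := hw w hwN hwx
    have a2 := hN.1 w hwN x hxN k (fun h' => h' hkN)
    have a3 := hM.1 w hwM k hkM x (fun h' => h' h.hx)
    have b1 := T.adj_iff w x hwx
    have b2 := T.adj_iff k w (by rintro rfl; exact hwN' hkN)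
    have b3 := T.adj_iff k x hkx
    grind only

end Crossing

end Obstruction

/-! ### One reversal at a vertex whose deletion leaves an indecomposable tournament -/

section Extension

variable {V : Type*} (T : Tournament V)

/-- The tournament obtained from `T` by deleting `v` is indecomposable. -/
def IsIndecomposableAway (v : V) : Prop :=
  ∀ D : Set V, v ∉ D → (∀ x ∈ D, ∀ y ∈ D, ∀ w ∉ D, w ≠ v → (T.Adj w x ↔ T.Adj w y)) →
    D.Subsingleton ∨ D = {v}ᶜ

variable {T}

open Classical in
-- Only an arc at `v` changes, so `K \ {v}` is a module of `T - v`: at most a point, or everything.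
theorem IsIndecomposableAway.nontrivialModule_flip {v w : V} (hR : T.IsIndecomposableAway v)
    (hvw : w ≠ v) {K : Set V}
    (hK : (T.flip (Equiv.swap v w) (isPairing_swap hvw.symm).1).IsNontrivialModule K) :
    K = {v}ᶜ ∨ ∃ u, u ≠ v ∧ K = {v, u} := by
  have h1 := hR (K \ {v}) (by simp) (by
    rintro x ⟨hx, hxv⟩ y ⟨hy, hyv⟩ z hz hzv
    have hzK : z ∉ K := fun h => hz ⟨h, hzv⟩
    have h := hK.1 x hx y hy z hzK
    have hs : ∀ a, a ≠ v → a ≠ z → Equiv.swap v w z ≠ a := by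
      intro a hav haz
      rw [Equiv.swap_apply_def]
      split_ifs <;> grind
    rwa [flip_adj_of_ne (hs x hxv (by rintro rfl; exact hzK hx)),
      flip_adj_of_ne (hs y hyv (by rintro rfl; exact hzK hy))] at h)
  rcases h1 with h1 | h1
  · right
    obtain ⟨u, hu, huv⟩ := hK.2.1.exists_ne v
    have hsub : ∀ a ∈ K, a = v ∨ a = u := fun a ha => by
      by_cases hav : a = v
      · exact Or.inl hav
      · exact Or.inr (h1 ⟨ha, hav⟩ ⟨hu, huv⟩)
    obtain ⟨a, ha, hau⟩ := hK.2.1.exists_ne u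
    have hav : a = v := (hsub a ha).resolve_right hau
    refine ⟨u, huv, ?_⟩
    ext b
    constructor
    · exact hsub b
    · rintro (rfl | rfl)
      · exact hav ▸ ha
      · exact hu
  · left
    by_cases hv : v ∈ K
    · refine (hK.2.2 ?_).elim
      ext a
      simp only [mem_univ, iff_true]
      by_cases hav : a = v
      · exact hav ▸ hv
      · have : a ∈ ({v}ᶜ : Set V) := hav
        rw [← h1] at this
        exact this.1
    · rw [← h1, sdiff_singleton_eq_self hv]

theorem exists_notMem_of_ncard_lt [Finite V] {S : Set V} (h : S.ncard < Nat.card V) :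
    ∃ x, x ∉ S := by
  by_contra hc
  push Not at hc
  rw [eq_univ_of_forall hc, ncard_univ] at h
  exact lt_irrefl _ h

theorem exists_ne_of_four [Finite V] (hV : 5 ≤ Nat.card V) (a b c d : V) :
    ∃ x, x ≠ a ∧ x ≠ b ∧ x ≠ c ∧ x ≠ d := by
  obtain ⟨x, hx⟩ := exists_notMem_of_ncard_lt (S := {a, b, c, d}) (by
    have h1 := ncard_insert_le a {b, c, d}
    have h2 := ncard_insert_le b {c, d}
    have h3 := ncard_insert_le c {d}
    have h4 := ncard_singleton d
    omega)
  simp only [mem_insert_iff, mem_singleton_iff, not_or] at hx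
  exact ⟨x, hx⟩

open Classical in
-- Let `v` be a source, the other case being dual. If reversing `vw` fails, some `u = f w` dominates
-- `T - v` except for `w`, which dominates `u`. Comparing two such vertices gives `f c = w` for
-- every `c` outside `{v, w, f w}`. Two such `c` exist among five vertices, and they contradict each
-- other.
theorem IsIndecomposableAway.exists_flip_of_extreme [Finite V] {v : V} (hV : 5 ≤ Nat.card V)
    (hR : T.IsIndecomposableAway v) (hv : T.IsExtremeIn v univ) :
    ∃ w, ∃ hvw : w ≠ v,
      (T.flip (Equiv.swap v w) (isPairing_swap hvw.symm).1).IsIndecomposable := by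
  by_contra hcon
  push Not at hcon
  have hv' : ∀ a b, a ≠ v → b ≠ v → (T.Adj v a ↔ T.Adj v b) :=
    fun a b ha hb => hv a (mem_univ _) b (mem_univ _) ha hb
  have bad : ∀ w, w ≠ v → ∃ u, u ≠ v ∧ u ≠ w ∧ (∀ z, z ≠ v → z ≠ u → z ≠ w →
      (T.Adj z v ↔ T.Adj z u)) ∧ (T.Adj v w ↔ T.Adj w u) := by
    intro w hvw
    have h1 := hcon w hvw
    rw [isIndecomposable_iff] at h1
    push Not at h1
    obtain ⟨K, hK⟩ := h1
    have s1 : ∀ z, z ≠ v → z ≠ w → Equiv.swap v w z = z :=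
      fun z h1 h2 => Equiv.swap_apply_of_ne_of_ne h1 h2
    have s2 : Equiv.swap v w v = w := Equiv.swap_apply_left _ _
    have s3 : Equiv.swap v w w = v := Equiv.swap_apply_right _ _
    rcases hR.nontrivialModule_flip hvw hK with rfl | ⟨u, huv, rfl⟩
    · exfalso
      obtain ⟨z, hz, -, -, hzw⟩ := exists_ne_of_four hV v v v w
      have := hK.1 z hz w hvw v (by simp)
      rw [flip_adj_of_ne (by rw [s2]; exact hzw.symm), flip_adj_of_eq s2] at this
      have h2 := hv' z w hz hvw
      have h3 := T.adj_iff v w hvw.symm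
      tauto
    · have hmod := hK.1 v (by simp) u (by simp)
      have huw : u ≠ w := by
        -- If `u = w`, then `w` would be extreme in `T - v`, making the remaining vertices a
        -- nontrivial module there.
        rintro rfl
        have h2 := hR {v, u}ᶜ (by simp) (by
          intro x hx y hy z hz hzv
          simp only [mem_compl_iff, mem_insert_iff, mem_singleton_iff, not_or] at hx hy
          have hzu : z = u := by simpa [hzv] using hz
          subst hzu
          have a1 := hmod x (by simp [hx])
          have a2 := hmod y (by simp [hy])
          rw [flip_adj_of_ne (by rw [s1 x hx.1 hx.2]; exact hx.1),
            flip_adj_of_ne (by rw [s1 x hx.1 hx.2]; exact hx.2)] at a1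
          rw [flip_adj_of_ne (by rw [s1 y hy.1 hy.2]; exact hy.1),
            flip_adj_of_ne (by rw [s1 y hy.1 hy.2]; exact hy.2)] at a2
          have b0 := hv' x y hx.1 hy.1
          have b1 := T.adj_iff x v hx.1
          have b2 := T.adj_iff y v hy.1
          have b3 := T.adj_iff x z hx.2
          have b4 := T.adj_iff y z hy.2
          grind only)
        obtain ⟨a, ha1, ha2, -, -⟩ := exists_ne_of_four hV v u v v
        obtain ⟨b, hb1, hb2, hb3, -⟩ := exists_ne_of_four hV v u a v
        rcases h2 with h2 | h2
        · exact hb3 (h2 (by simp [hb1, hb2]) (by simp [ha1, ha2]))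
        · have : u ∈ ({v}ᶜ : Set V) := huv
          rw [← h2] at this
          simp at this
      refine ⟨u, huv, huw, ?_, ?_⟩
      · intro z hzv hzu hzw
        have a1 := hmod z (by simp [hzv, hzu])
        rwa [flip_adj_of_ne (by rw [s1 z hzv hzw]; exact hzv),
          flip_adj_of_ne (by rw [s1 z hzv hzw]; exact hzu)] at a1
      · have a1 := hmod w (by simp [hvw, huw.symm])
        rwa [flip_adj_of_eq s3, flip_adj_of_ne (by rw [s3]; exact huv.symm)] at a1
  choose f f1 f2 f3 f4 using bad
  obtain ⟨w, hw, -, -, -⟩ := exists_ne_of_four hV v v v v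
  obtain ⟨a, a1, a2, a3, -⟩ := exists_ne_of_four hV v w (f w hw) v
  obtain ⟨b, b1, b2, b3, b4⟩ := exists_ne_of_four hV v w (f w hw) a
  have key : ∀ c (hc : c ≠ v), c ≠ w → c ≠ f w hw → f c hc = w := by
    intro c hc hcw hcf
    by_contra hne
    have e1 := f3 w hw
    have e3 := f3 c hc
    have e4 := f4 c hc
    have n1 := f1 w hw
    have n2 := f1 c hc
    have n3 := f2 w hw
    have n4 := f2 c hc
    by_cases h : f c hc = f w hw
    · have g1 := e1 c hc hcf hcw
      have g2 := T.adj_iff v c hc.symm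
      rw [h] at e4
      tauto
    · have g1 := e1 _ n2 h hne
      have g2 := e3 _ n1 (Ne.symm h) (Ne.symm hcf)
      have g3 := T.adj_iff _ _ h
      have g4 := T.adj_iff v _ n1.symm
      have g5 := T.adj_iff v _ n2.symm
      have g6 := hv' _ _ n1 n2
      tauto
  have ka := key a a1 a2 a3
  have kb := key b b1 b2 b3
  have e1 := f3 a a1 b b1 (by rw [ka]; exact b2) b4
  have e2 := f4 b b1
  rw [ka] at e1
  rw [kb] at e2
  have e3 := T.adj_iff v b b1.symm
  tauto

open Classical in
-- If reversing `vw` fails, then either `I = {w}` or some `u ∈ I` differs from `p` in `T - v` only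
-- at `w`; such a `u` determines `w`. So the `|V| - 2` vertices other than `v`, `p` inject into `I`,
-- up to one exception when `I` is a singleton. Five vertices exclude the exception; otherwise `I`
-- is everything, and `p` is a source or sink of `T - v`.
theorem IsIndecomposableAway.exists_flip_of_twin [Finite V] {v p : V} (hV : 5 ≤ Nat.card V)
    (hR : T.IsIndecomposableAway v) (hpv : p ≠ v) (hm : T.IsModule {v, p}) :
    ∃ w, ∃ hvw : w ≠ v,
      (T.flip (Equiv.swap v w) (isPairing_swap hvw.symm).1).IsIndecomposable := by
  by_contra hcon
  push Not at hcon
  have hm' : ∀ z, z ≠ v → z ≠ p → (T.Adj z v ↔ T.Adj z p) := by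
    intro z h1 h2
    exact hm v (by simp) p (by simp) z (by simp [h1, h2])
  let I : Set V := {u | u ≠ v ∧ u ≠ p ∧ (T.Adj p u ↔ T.Adj p v)}
  let Q : V → V → Prop := fun u w => (∀ z, z ≠ v → z ≠ p → z ≠ u → z ≠ w →
    (T.Adj z p ↔ T.Adj z u)) ∧ ¬ (T.Adj w p ↔ T.Adj w u) ∧ w ≠ u
  have bad : ∀ w, w ≠ v → w ≠ p → I = {w} ∨ ∃ u ∈ I, Q u w := by
    intro w hvw hwp
    have h1 := hcon w hvw
    rw [isIndecomposable_iff] at h1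
    push Not at h1
    obtain ⟨K, hK⟩ := h1
    have s1 : ∀ z, z ≠ v → z ≠ w → Equiv.swap v w z = z :=
      fun z h1 h2 => Equiv.swap_apply_of_ne_of_ne h1 h2
    have s2 : Equiv.swap v w v = w := Equiv.swap_apply_left _ _
    have s3 : Equiv.swap v w w = v := Equiv.swap_apply_right _ _
    rcases hR.nontrivialModule_flip hvw hK with rfl | ⟨u, huv, rfl⟩
    · left
      have hmod := fun a ha => hK.1 a ha p hpv v (by simp)
      have n1 := T.adj_iff v p hpv.symm
      ext z
      by_cases hzv : z = v
      · subst hzv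
        simp [I, hvw.symm]
      by_cases hzp : z = p
      · subst hzp
        simp [I, hwp.symm]
      have n2 := T.adj_iff v z (Ne.symm hzv)
      have n3 := T.adj_iff p z (Ne.symm hzp)
      have n4 := hm' z hzv hzp
      by_cases hzw : z = w
      · subst hzw
        have a1 := hmod z hzv
        rw [flip_adj_of_eq s2, flip_adj_of_ne (by rw [s2]; exact hwp)] at a1
        have : (T.Adj p z ↔ T.Adj p v) := by tauto
        simp [I, hzv, hzp, this]
      · have a1 := hmod z hzv
        rw [flip_adj_of_ne (by rw [s2]; exact Ne.symm hzw),
          flip_adj_of_ne (by rw [s2]; exact hwp)] at a1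
        have : ¬ (T.Adj p z ↔ T.Adj p v) := by tauto
        simp [I, hzw, this]
    · right
      have hmod := hK.1 v (by simp) u (by simp)
      have huw : u ≠ w := by
        rintro rfl
        have hsub : ∀ z, z ≠ v → z ≠ u → (T.Adj z v ↔ T.Adj z u) := by
          intro z h1 h2
          have a1 := hmod z (by simp [h1, h2])
          rwa [flip_adj_of_ne (by rw [s1 z h1 h2]; exact h1),
            flip_adj_of_ne (by rw [s1 z h1 h2]; exact h2)] at a1
        have h2 := hR {p, u} (by simp [hpv.symm, huv.symm]) (by
          have : ∀ a ∈ ({p, u} : Set V), ∀ z ∉ ({p, u} : Set V), z ≠ v →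
              (T.Adj z a ↔ T.Adj z v) := by
            intro a ha z hz hzv
            simp only [mem_insert_iff, mem_singleton_iff, not_or] at hz
            rcases ha with rfl | rfl
            · exact (hm' z hzv hz.1).symm
            · exact (hsub z hzv hz.2).symm
          intro x hx y hy z hz hzv
          rw [this x hx z hz hzv, this y hy z hz hzv])
        rcases h2 with h2 | h2
        · exact hwp (h2 (by simp) (by simp))
        · obtain ⟨a, a1, a2, a3, -⟩ := exists_ne_of_four hV v p u v
          have : a ∈ ({v}ᶜ : Set V) := a1
          rw [← h2] at this
          simp [a2, a3] at this
      have a1 := hmod w (by simp [hvw, huw.symm])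
      rw [flip_adj_of_eq s3, flip_adj_of_ne (by rw [s3]; exact huv.symm)] at a1
      have a2 := hm' w hvw hwp
      have n1 := T.adj_iff v w hvw.symm
      have hup : u ≠ p := by
        rintro rfl
        tauto
      have hz : ∀ z, z ≠ v → z ≠ u → z ≠ w → (T.Adj z v ↔ T.Adj z u) := by
        intro z h1 h2 h3
        have a1 := hmod z (by simp [h1, h2])
        rwa [flip_adj_of_ne (by rw [s1 z h1 h3]; exact h1),
          flip_adj_of_ne (by rw [s1 z h1 h3]; exact h2)] at a1
      refine ⟨u, ⟨huv, hup, (hz p hpv hup.symm hwp.symm).symm⟩, ?_, by tauto, huw.symm⟩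
      intro z h1 h2 h3 h4
      rw [← hz z h1 h3 h4, hm' z h1 h2]
  have hQ : ∀ u w w', u ∈ I → w ≠ v → w ≠ p → Q u w → Q u w' → w = w' := by
    intro u w w' hu h1 h2 h h'
    by_contra hne
    exact h.2.1 (h'.1 w h1 h2 h.2.2 hne)
  -- `g u` is the only `w` that `u` can serve, with default `u` if there is none.
  have hg : ∀ u, ∃ w, ∀ w', u ∈ I → w' ≠ v → w' ≠ p → Q u w' → w' = w := by
    intro u
    by_cases h : ∃ w, u ∈ I ∧ w ≠ v ∧ w ≠ p ∧ Q u w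
    · obtain ⟨w, h1, h2, h3, h4⟩ := h
      exact ⟨w, fun w' _ g1 g2 g3 => hQ u w' w h1 g1 g2 g3 h4⟩
    · exact ⟨u, fun w' g0 g1 g2 g3 => (h ⟨w', g0, g1, g2, g3⟩).elim⟩
  choose g hg using hg
  have hIsub : I ⊆ {v, p}ᶜ := by
    rintro u ⟨h1, h2, -⟩
    simp [h1, h2]
  have hcard : ({v, p}ᶜ : Set V).ncard + 2 = Nat.card V := by
    rw [← ncard_pair hpv.symm, add_comm, ncard_add_ncard_compl]
  have hImg : (g '' I).ncard ≤ I.ncard := ncard_image_le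
  have hcov : ∀ w, w ≠ v → w ≠ p → I = {w} ∨ w ∈ g '' I := by
    intro w h1 h2
    rcases bad w h1 h2 with h | ⟨u, hu, h⟩
    · exact Or.inl h
    · exact Or.inr ⟨u, hu, (hg u w hu h1 h2 h).symm⟩
  by_cases hI : ∃ w, I = {w}
  · obtain ⟨w, hw⟩ := hI
    have hsub : ({v, p}ᶜ : Set V) ⊆ {w} ∪ g '' I := by
      intro a ha
      simp only [mem_compl_iff, mem_insert_iff, mem_singleton_iff, not_or] at ha
      rcases hcov a ha.1 ha.2 with h | h
      · rw [hw] at h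
        exact Or.inl (singleton_injective h).symm
      · exact Or.inr h
    have c1 := ncard_le_ncard hsub
    have c2 := ncard_union_le {w} (g '' I)
    have c3 : I.ncard = 1 := by rw [hw, ncard_singleton]
    have c4 := ncard_singleton w
    omega
  · push Not at hI
    have hsub : ({v, p}ᶜ : Set V) ⊆ g '' I := by
      intro a ha
      simp only [mem_compl_iff, mem_insert_iff, mem_singleton_iff, not_or] at ha
      exact (hcov a ha.1 ha.2).resolve_left (hI a)
    have hIeq : I = {v, p}ᶜ :=
      eq_of_subset_of_ncard_le hIsub ((ncard_le_ncard hsub).trans hImg)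
    have h2 := hR {v, p}ᶜ (by simp) (by
      intro x hx y hy z hz hzv
      have hzp : z = p := by simpa [hzv] using hz
      subst hzp
      rw [← hIeq] at hx hy
      rw [hx.2.2, hy.2.2])
    rcases h2 with h2 | h2
    · have := ncard_le_one_iff_subsingleton.mpr h2
      omega
    · have : p ∈ ({v}ᶜ : Set V) := hpv
      rw [← h2] at this
      simp at this

end Extension

/-! ### Large pairings create no new module; transversals with two elements -/

section UpperBound

variable {V : Type*} {T : Tournament V}

theorem IsExtremeIn.isNontrivialModule {x : V} (h : T.IsExtremeIn x univ)
    (hne : ({x}ᶜ : Set V).Nontrivial) : T.IsNontrivialModule {x}ᶜ := by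
  refine ⟨fun a ha b hb v hv => ?_, hne, ?_⟩
  · have hvx : v = x := by simpa using hv
    subst hvx
    exact h a (mem_univ _) b (mem_univ _) ha hb
  · intro h'
    have := h' ▸ mem_univ x
    exact this rfl

/-- A source or sink `x` would make `{x}` a comodule strictly inside `M`. -/
theorem IsMinComodule.not_extreme {M : Set V} (hM : T.IsMinComodule M)
    (hn : T.IsNontrivialModule M) {x : V} (hx : x ∈ M) : ¬ T.IsExtremeIn x univ := by
  intro h
  obtain ⟨x', hx', hne⟩ := hn.2.1.exists_ne x
  obtain ⟨w, hw⟩ := (ne_univ_iff_exists_notMem M).mp hn.2.2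
  have h1 : T.IsComodule {x} := Or.inr (h.isNontrivialModule
    ⟨x', hne, w, by rintro rfl; exact hw hx, by rintro rfl; exact hw hx'⟩)
  have := hM.eq_of_subset h1 (by simpa using hx)
  exact hn.2.1.ne_singleton this.symm

/-- If both `M` and `Mᶜ` were modules, all arcs between them would point the same way, so one of
`x`, `x'` would be a source or sink. -/
theorem IsMinComodule.not_isModule_compl {M : Set V} (hM : T.IsMinComodule M)
    (hn : T.IsNontrivialModule M) {x x' : V} (hx : M = {x, x'}) : ¬ T.IsModule Mᶜ := by
  intro h
  obtain ⟨w, hw⟩ := (ne_univ_iff_exists_notMem M).mp hn.2.2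
  have hxM : x ∈ M := by simp [hx]
  have hxM' : x' ∈ M := by simp [hx]
  have hxx' : x ≠ x' := by
    rintro rfl
    exact hn.2.1.ne_singleton (by simpa using hx)
  have key : ∀ a ∈ M, ∀ u ∉ M, (T.Adj a u ↔ T.Adj x w) := by
    intro a ha u hu
    have a1 := h u hu w hw a (fun h' => h' ha)
    have a2 := hn.1 a ha x hxM w hw
    have b1 := T.adj_iff a w (by rintro rfl; exact hw ha)
    have b2 := T.adj_iff x w (by rintro rfl; exact hw hxM)
    grind only
  have fin : ∀ a ∈ M, ∀ b, M ⊆ {a, b} → (T.Adj a b ↔ T.Adj x w) → T.IsExtremeIn a univ := by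
    intro a ha b hab h1
    have : ∀ u, u ≠ a → (T.Adj a u ↔ T.Adj x w) := by
      intro u hua
      by_cases hu : u ∈ M
      · rcases hab hu with h | h
        · exact (hua h).elim
        · rwa [show u = b from h]
      · exact key a ha u hu
    intro u _ v _ hu hv
    rw [this u hu, this v hv]
  by_cases hc : T.Adj x x' ↔ T.Adj x w
  · exact hM.not_extreme hn hxM (fin x hxM x' hx.le hc)
  · refine hM.not_extreme hn hxM' (fin x' hxM' x (by rw [hx, pair_comm]) ?_)
    have := T.adj_iff x x' hxx'
    tauto

/-- In the twin and end configurations the union is a module by definition. In the extreme one its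
complement is a module: `x` is extreme in `Nᶜ`, and its twin sees the complement as `x` does. -/
theorem Obstructed.isComodule_union {x y : V} {M N : Set V} (h : T.Obstructed x M y N)
    (hx : x ∈ M) (hxN : x ∉ N) (hW : (M ∪ N)ᶜ.Nontrivial) : T.IsComodule (M ∪ N) := by
  have hne : M ∪ N ≠ univ := by
    intro h'
    rw [h'] at hW
    simpa using hW.nonempty
  rcases h with h | h | h
  · exact Or.inl ⟨h.2.2.1, h.1.2.1.mono subset_union_left, hne⟩
  · obtain ⟨hM, ⟨x', rfl⟩, hN, hext, -⟩ := h
    refine Or.inr ⟨?_, hW, ?_⟩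
    · rintro a ha b hb v hv
      simp only [mem_compl_iff, mem_union, not_or] at ha hb hv
      by_cases hvN : v ∈ N
      · exact hN.1 a ha.2 b hb.2 v (fun h' => h' hvN)
      · have hvM : v ∈ ({x, x'} : Set V) := by_contra fun h' => hv ⟨h', hvN⟩
        have hax : a ≠ x := by rintro rfl; exact ha.1 hx
        have hbx : b ≠ x := by rintro rfl; exact hb.1 hx
        have e := hext a ha.2 b hb.2 hax hbx
        have e1 := hM.1 v hvM x hx a ha.1
        have e2 := hM.1 v hvM x hx b hb.1
        have b1 := T.adj_iff a x hax
        have b2 := T.adj_iff b x hbx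
        have b3 := T.adj_iff a v (by rintro rfl; exact ha.1 hvM)
        have b4 := T.adj_iff b v (by rintro rfl; exact hb.1 hvM)
        grind only
    · intro h'
      have : x ∈ (({x, x'} : Set V) ∪ N)ᶜ := h' ▸ mem_univ x
      exact this (Or.inl hx)
  · exact Or.inl ⟨h.2.2.2, h.2.2.1.2.1.mono subset_union_right, hne⟩

namespace IsTransversal

variable {X : Set V} {M : V → Set V}

theorem eq_of_mem (ht : T.IsTransversal X M) {x u : V} (hx : x ∈ X) (hu : u ∈ X)
    (h : u ∈ M x) : u = x := by
  by_contra hne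
  exact disjoint_left.mp (ht.disjoint u hu x hx hne) (ht.mem u hu) h

theorem notMem (ht : T.IsTransversal X M) {x y u : V} (hx : x ∈ X) (hy : y ∈ X) (hxy : x ≠ y)
    (h : u ∈ M x) : u ∉ M y :=
  disjoint_left.mp (ht.disjoint x hx y hy hxy) h

theorem crossing (ht : T.IsTransversal X M) {σ : Equiv.Perm V} {Y : Set V} (hσ : IsPairing σ Y)
    (hY : Y ⊆ X) {K : Set V} (hK : (T.flip σ hσ.1).IsNontrivialModule K) {x : V} (hx : x ∈ K)
    (hx' : σ x ∉ K) : Crossing T σ hσ.1 x (M x) (σ x) (M (σ x)) K := by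
  have hne : σ x ≠ x := by
    intro h
    rw [h] at hx'
    exact hx' hx
  have hxY := (hσ.2 x).mp hne
  have hyY := hσ.apply_mem hxY
  exact
  { minM := ht.isMin x (hY hxY)
    minN := ht.isMin _ (hY hyY)
    disj := fun u hu => ht.notMem (hY hxY) (hY hyY) hne.symm hu
    hx := ht.mem x (hY hxY)
    hy := ht.mem _ (hY hyY)
    hxy := rfl
    fixM := fun u hu hux => hσ.apply_eq fun h => hux (ht.eq_of_mem (hY hxY) (hY h) hu)
    fixN := fun u hu hux => hσ.apply_eq fun h => hux (ht.eq_of_mem (hY hyY) (hY h) hu)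
    mod := hK.1
    nontriv := hK.2.1
    hxK := hx
    hyK := hx' }

/-- A sufficiently large covering pairing creates no new nontrivial module. -/
theorem not_covers_of_flip [Finite V] (ht : T.IsTransversal X M) {σ : Equiv.Perm V} {Y : Set V}
    (hσ : IsPairing σ Y) (hY : Y ⊆ X) (hcard : 4 ≤ Y.ncard)
    (hc : ∀ D, T.IsComodule D → ¬ Covers σ D → (D ∩ Y).Nonempty → (Dᶜ ∩ Y).Nonempty → False)
    {K : Set V} (hK : (T.flip σ hσ.1).IsNontrivialModule K) : ¬ Covers σ K := by
  rintro ⟨x, hx, hx'⟩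
  have hne : σ x ≠ x := by
    intro h
    rw [h] at hx'
    exact hx' hx
  have hxY := (hσ.2 x).mp hne
  have hyY := hσ.apply_mem hxY
  -- With at least four paired vertices, two lie outside `M x ∪ M (σ x)`, as needed for the union to
  -- be a comodule.
  have h2 : 1 < (Y \ {x, σ x}).ncard := by
    have := ncard_sdiff_add_ncard_of_subset (s := {x, σ x}) (t := Y)
      (by rintro _ (rfl | rfl) <;> assumption)
    rw [ncard_pair hne.symm] at this
    omega
  rw [one_lt_ncard_iff_nontrivial] at h2
  have hsub : Y \ {x, σ x} ⊆ (M x ∪ M (σ x))ᶜ := by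
    rintro u ⟨huY, hu⟩ h'
    simp only [mem_insert_iff, mem_singleton_iff, not_or] at hu
    rcases h' with h' | h'
    · exact hu.1 (ht.eq_of_mem (hY hxY) (hY huY) h')
    · exact hu.2 (ht.eq_of_mem (hY hyY) (hY huY) h')
  have hD : T.IsComodule (M x ∪ M (σ x)) := by
    rcases (ht.crossing hσ hY hK hx hx').obstructed with h | h
    · exact h.isComodule_union (ht.mem x (hY hxY))
        (ht.notMem (hY hxY) (hY hyY) hne.symm (ht.mem x (hY hxY))) (h2.mono hsub)
    · rw [union_comm]
      refine h.isComodule_union (ht.mem _ (hY hyY))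
        (ht.notMem (hY hyY) (hY hxY) hne (ht.mem _ (hY hyY))) ?_
      rw [union_comm]
      exact h2.mono hsub
  -- This union meets `Y` exactly in `x` and `σ x`, so it is uncovered and yet splits `Y`.
  refine hc _ hD ?_ ⟨x, Or.inl (ht.mem x (hY hxY)), hxY⟩ ?_
  · rintro ⟨u, hu, hu'⟩
    by_cases huY : u ∈ Y
    · apply hu'
      rcases hu with hu | hu
      · rw [ht.eq_of_mem (hY hxY) (hY huY) hu]
        exact Or.inr (ht.mem _ (hY hyY))
      · rw [ht.eq_of_mem (hY hyY) (hY huY) hu, hσ.1]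
        exact Or.inl (ht.mem x (hY hxY))
    · rw [hσ.apply_eq huY] at hu'
      exact hu' hu
  · obtain ⟨u, hu⟩ := h2.nonempty
    exact ⟨u, hsub hu, hu.1⟩

/-- No comodule avoids both `x` and `y`, so the obstruction determines much of `T`. The twin case
contradicts `not_isModule_compl`. In the other two, deleting a twin of `x`, or the source or sink
`x` itself, leaves an indecomposable tournament, and one reversal at the deleted vertex works. -/
theorem two_of_obstructed [Finite V] (hV : 5 ≤ Nat.card V) {x y : V} (hxy : x ≠ y)
    (ht : T.IsTransversal {x, y} M) (h : T.Obstructed x (M x) y (M y)) :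
    ∃ T' : Tournament V, T'.IsIndecomposable ∧ (T.reversedArcs T').ncard ≤ 1 := by
  classical
  have hx := ht.mem x (by simp)
  have hy := ht.mem y (by simp)
  have hmM := ht.isMin x (by simp)
  have hmN := ht.isMin y (by simp)
  have hd : ∀ u ∈ M x, u ∉ M y := fun u hu => ht.notMem (by simp) (by simp) hxy hu
  have hit : ∀ D, T.IsComodule D → x ∉ D → y ∉ D → False := by
    intro D hD h1 h2
    obtain ⟨u, rfl | rfl, hu⟩ := ht.hit D hD
    · exact h1 hu
    · exact h2 hu
  have finish : ∀ v, (∃ w, ∃ hvw : w ≠ v,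
      (T.flip (Equiv.swap v w) (isPairing_swap hvw.symm).1).IsIndecomposable) →
      ∃ T' : Tournament V, T'.IsIndecomposable ∧ (T.reversedArcs T').ncard ≤ 1 := by
    rintro v ⟨w, hvw, hw⟩
    refine ⟨_, hw, ?_⟩
    have := (isPairing_swap hvw.symm).ncard_reversedArcs (T := T)
    rw [ncard_pair hvw.symm] at this
    omega
  generalize M x = P at *
  generalize M y = N at *
  have hunion : T.IsModule (P ∪ N) → N.Nontrivial → P ∪ N = univ := by
    intro hm hn
    by_contra hne
    exact hit _ (IsComodule.compl (Or.inl ⟨hm, hn.mono subset_union_right, hne⟩))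
      (fun h' => h' (Or.inl hx)) (fun h' => h' (Or.inr hy))
  have hcompl : P ∪ N = univ → N = Pᶜ := by
    intro hu
    ext u
    constructor
    · intro h1 h2
      exact hd u h2 h1
    · intro h1
      have : u ∈ P ∪ N := hu ▸ mem_univ u
      exact this.resolve_left h1
  have h0 := h
  rcases h with h | h | h
  · obtain ⟨hP, hN, hm, x', hx'⟩ := h
    have := hcompl (hunion hm hN.2.1)
    exact (hmM.not_isModule_compl hP hx' (this ▸ hN.1)).elim
  · obtain ⟨hP, ⟨x', hx'⟩, hN, hext, -⟩ := h
    have hx'P : x' ∈ P := by simp [hx']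
    have hxx' : x ≠ x' := by
      rintro rfl
      exact hP.2.1.ne_singleton (by simpa using hx')
    have hW : (P ∪ N)ᶜ.Subsingleton := by
      by_contra hW
      rw [not_subsingleton_iff] at hW
      exact hit _ (h0.isComodule_union hx (hd x hx) hW).compl
        (fun h' => h' (Or.inl hx)) (fun h' => h' (Or.inr hy))
    have hPN : P ∪ N = univ := by
      by_contra hne
      obtain ⟨w, hw⟩ := (ne_univ_iff_exists_notMem _).mp hne
      have hwP : w ∉ P := fun h' => hw (Or.inl h')
      have hwN : w ∉ N := fun h' => hw (Or.inr h')
      -- The only vertex `w` outside `P ∪ N` would form with `x'` a module avoiding `x` and `y`.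
      refine hit {x', w} (Or.inl ⟨?_, ⟨x', by simp, w, by simp, ?_⟩, ?_⟩) ?_ ?_
      · have key : ∀ v ∉ ({x', w} : Set V), (T.Adj v x' ↔ T.Adj v w) := by
          intro v hv
          simp only [mem_insert_iff, mem_singleton_iff, not_or] at hv
          by_cases hvN : v ∈ N
          · exact hN.1 x' (hd x' hx'P) w hwN v (fun h' => h' hvN)
          · by_cases hvP : v ∈ P
            · have hvx : v = x := by
                rw [hx'] at hvP
                exact hvP.resolve_right hv.1
              rw [hvx]
              exact hext x' (hd x' hx'P) w hwN hxx'.symm (by rintro rfl; exact hwP hx)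
            · exact (hv.2 (hW (fun h' => h'.elim hvP hvN) hw)).elim
        rintro a (rfl | rfl) b (rfl | rfl) v hv
        · rfl
        · exact key v hv
        · exact (key v hv).symm
        · rfl
      · rintro rfl
        exact hwP hx'P
      · intro h'
        have : y ∈ ({x', w} : Set V) := h' ▸ mem_univ y
        rcases this with rfl | rfl
        · exact hd _ hx'P hy
        · exact hwN hy
      · rintro (h' | rfl)
        · exact hxx' h'
        · exact hwP hx
      · rintro (rfl | rfl)
        · exact hd _ hx'P hy
        · exact hwN hy
    have hNP := hcompl hPN
    refine finish x' (IsIndecomposableAway.exists_flip_of_twin hV ?_ hxx' ?_)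
    -- A nontrivial module `D` of `T - x'` extends by `x'` if it contains `x`, and otherwise is
    -- already a module of `T`. Minimality of `N = Pᶜ` then forces `D = {x}` or `D = N`, both
    -- impossible.
    · intro D hx'D hD
      by_contra hcon
      rw [not_or, not_subsingleton_iff] at hcon
      obtain ⟨hDn, hDne⟩ := hcon
      have htw : ∀ v, v ≠ x → v ≠ x' → (T.Adj v x ↔ T.Adj v x') := by
        intro v h1 h2
        exact hP.1 x hx x' hx'P v (by rw [hx']; simp [h1, h2])
      by_cases hxD : x ∈ D
      · have hmod : T.IsModule (insert x' D) := by
          have key : ∀ a ∈ insert x' D, ∀ v ∉ insert x' D, (T.Adj v a ↔ T.Adj v x) := by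
            intro a ha v hv
            simp only [mem_insert_iff, not_or] at hv
            rcases ha with rfl | ha
            · exact (htw v (by rintro rfl; exact hv.2 hxD) hv.1).symm
            · exact hD a ha x hxD v hv.2 hv.1
          intro a ha b hb v hv
          rw [key a ha v hv, key b hb v hv]
        have hne : insert x' D ≠ univ := by
          intro h'
          apply hDne
          ext a
          constructor
          · intro ha
            rintro rfl
            exact hx'D ha
          · intro ha
            have : a ∈ insert x' D := h' ▸ mem_univ a
            exact this.resolve_left ha
        have hco : T.IsComodule (insert x' D)ᶜ :=
          IsComodule.compl (Or.inl ⟨hmod, hDn.mono (subset_insert _ _), hne⟩)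
        have heq := hmN.eq_of_subset hco (by
          rw [hNP, compl_subset_compl, hx']
          rintro a (rfl | rfl)
          · exact Or.inr hxD
          · exact Or.inl rfl)
        rw [hNP, compl_inj_iff, hx'] at heq
        obtain ⟨d, hd1, hd2⟩ := hDn.exists_ne x
        have : d ∈ ({x, x'} : Set V) := heq ▸ Or.inr hd1
        rcases this with rfl | rfl
        · exact hd2 rfl
        · exact hx'D hd1
      · have hmod : T.IsModule D := by
          intro a ha b hb v hv
          by_cases hvx : v = x'
          · subst hvx
            have hax : a ≠ x := by rintro rfl; exact hxD ha
            have hbx : b ≠ x := by rintro rfl; exact hxD hb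
            have hav : a ≠ v := by rintro rfl; exact hx'D ha
            have hbv : b ≠ v := by rintro rfl; exact hx'D hb
            have e := hD a ha b hb x hxD hxx'
            have e1 := htw a hax hav
            have e2 := htw b hbx hbv
            have n1 := T.adj_iff a x hax
            have n2 := T.adj_iff b x hbx
            have n3 := T.adj_iff a v hav
            have n4 := T.adj_iff b v hbv
            grind only
          · exact hD a ha b hb v hv hvx
        have hDuniv : D ≠ univ := by
          rintro rfl
          exact hxD (mem_univ _)
        have heq := hmN.eq_of_subset (Or.inl ⟨hmod, hDn, hDuniv⟩) (by
          rw [hNP, hx']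
          rintro a ha (rfl | rfl)
          · exact hxD ha
          · exact hx'D ha)
        rw [heq, hNP] at hmod
        exact hmM.not_isModule_compl hP hx' hmod
    · rw [pair_comm, ← hx']
      exact hP.1
  · obtain ⟨rfl, hP, hN, hm⟩ := h
    have hNP := hcompl (hunion hm hN.2.1)
    have hext : T.IsExtremeIn x univ := by
      intro u _ v _ hu hv
      exact hP.1 u hu v hv x (fun h' => h' rfl)
    refine finish x (IsIndecomposableAway.exists_flip_of_extreme hV ?_ hext)
    intro D hxD hD
    by_cases hDn : D.Nontrivial
    · right
      rw [← hNP]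
      refine hmN.eq_of_subset (Or.inl ⟨?_, hDn, ?_⟩) ?_
      · intro a ha b hb v hv
        by_cases hvx : v = x
        · subst hvx
          exact hext a (mem_univ _) b (mem_univ _) (by rintro rfl; exact hv ha)
            (by rintro rfl; exact hv hb)
        · exact hD a ha b hb v hv hvx
      · rintro rfl
        exact hxD (mem_univ _)
      · rw [hNP]
        rintro a ha rfl
        exact hxD ha
    · exact Or.inl (not_nontrivial_iff.mp hDn)

open Classical in
/-- If neither orientation of the pair is obstructed, the modules created by reversing one arc
do not separate its ends. -/
theorem not_covers_of_swap (ht : T.IsTransversal X M) {x y : V} (hxy : x ≠ y) (hx : x ∈ X)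
    (hy : y ∈ X) (h1 : ¬ T.Obstructed x (M x) y (M y)) (h2 : ¬ T.Obstructed y (M y) x (M x))
    {K : Set V} (hK : (T.flip (Equiv.swap x y) (isPairing_swap hxy).1).IsNontrivialModule K) :
    ¬ Covers (Equiv.swap x y) K := by
  rintro ⟨u, hu, hu'⟩
  have hne : Equiv.swap x y u ≠ u := by
    intro h
    rw [h] at hu'
    exact hu' hu
  have hcr := (ht.crossing (isPairing_swap hxy)
    (by rintro _ (rfl | rfl) <;> assumption) hK hu hu').obstructed
  rcases ((isPairing_swap hxy).2 u).mp hne with rfl | h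
  · rw [Equiv.swap_apply_left] at hcr
    tauto
  · have h : u = y := h
    subst h
    rw [Equiv.swap_apply_right] at hcr
    tauto

/-- If the pair is unobstructed, reversing its arc leaves only modules of `T` containing both or
neither of `x`, `y`; such a module or its complement would miss the transversal. -/
theorem exists_of_two [Finite V] (hV : 5 ≤ Nat.card V) {x y : V} (hxy : x ≠ y)
    (ht : T.IsTransversal {x, y} M) :
    ∃ T' : Tournament V, T'.IsIndecomposable ∧ (T.reversedArcs T').ncard ≤ 1 := by
  classical
  by_cases h1 : T.Obstructed x (M x) y (M y)
  · exact two_of_obstructed hV hxy ht h1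
  by_cases h2 : T.Obstructed y (M y) x (M x)
  · exact two_of_obstructed hV hxy.symm (by rwa [pair_comm]) h2
  refine ⟨T.flip (Equiv.swap x y) (isPairing_swap hxy).1, ?_, ?_⟩
  · rw [isIndecomposable_iff]
    intro K hK
    have hc := ht.not_covers_of_swap hxy (by simp) (by simp) h1 h2 hK
    have hinv : ∀ u ∈ K, Equiv.swap x y u ∈ K := by
      intro u hu
      by_contra h'
      exact hc ⟨u, hu, h'⟩
    have hKT : T.IsComodule K := Or.inl (hK.of_flip hinv)
    have e1 : x ∈ K → y ∈ K := fun h => by simpa using hinv x h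
    have e2 : y ∈ K → x ∈ K := fun h => by simpa using hinv y h
    obtain ⟨u, hu, huK⟩ := ht.hit _ hKT
    obtain ⟨v, hv, hvK⟩ := ht.hit _ hKT.compl
    have hvK' : v ∉ K := hvK
    rcases hu with rfl | rfl <;> rcases hv with rfl | rfl <;> tauto
  · have := (isPairing_swap hxy).ncard_reversedArcs (T := T)
    rw [ncard_pair hxy] at this
    omega

end IsTransversal

end UpperBound

/-! ### Transversals with three elements, and the general upper bound -/

section Three

variable {V : Type*} {T : Tournament V} {X : Set V} {M : V → Set V}

namespace IsTransversal

theorem obstructed_cases {x y : V} {M N : Set V}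
    (h : T.Obstructed x M y N ∨ T.Obstructed y N x M) :
    T.IsModule (M ∪ N) ∨ T.ObstructedExtreme x M y N ∨ T.ObstructedExtreme y N x M := by
  rcases h with (h | h | h) | (h | h | h)
  · exact Or.inl h.2.2.1
  · exact Or.inr (Or.inl h)
  · exact Or.inl h.2.2.2
  · exact Or.inl (union_comm N M ▸ h.2.2.1)
  · exact Or.inr (Or.inr h)
  · exact Or.inl (union_comm N M ▸ h.2.2.2)

/-- The complements of the disjoint sets `M b` and `M c` cover `V` and share the twin of `a`, so `a`
would be a source or sink of `T`. -/
theorem not_extreme_extreme (ht : T.IsTransversal X M) {a b c : V} (ha : a ∈ X) (hb : b ∈ X)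
    (hc : c ∈ X) (hab : a ≠ b) (hac : a ≠ c) (hbc : b ≠ c)
    (h1 : T.ObstructedExtreme a (M a) b (M b)) (h2 : T.ObstructedExtreme a (M a) c (M c)) :
    False := by
  refine (ht.isMin a ha).not_extreme h1.1 (ht.mem a ha) ?_
  obtain ⟨a', ha', hne⟩ := h1.1.2.1.exists_ne a
  have e1 : a' ∉ M b := ht.notMem ha hb hab ha'
  have e2 : a' ∉ M c := ht.notMem ha hc hac ha'
  have key : ∀ u, u ≠ a → (T.Adj a u ↔ T.Adj a a') := by
    intro u hu
    by_cases hub : u ∈ M b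
    · exact h2.2.2.2.1 u (ht.notMem hb hc hbc hub) a' e2 hu hne
    · exact h1.2.2.2.1 u hub a' e1 hu hne
  intro u _ v _ hu hv
  rw [key u hu, key v hv]

/-- `a` sees `(M a)ᶜ` uniformly and is extreme in `(M b)ᶜ`; these cover `V` and share `c`, so `a`
would be a source or sink. -/
theorem not_extreme_of_compl (ht : T.IsTransversal X M) {a b c : V} (ha : a ∈ X) (hb : b ∈ X)
    (hc : c ∈ X) (hab : a ≠ b) (hac : a ≠ c) (hbc : b ≠ c)
    (h1 : T.ObstructedExtreme a (M a) b (M b)) (h2 : T.IsNontrivialModule (M a)ᶜ) : False := by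
  refine (ht.isMin a ha).not_extreme h1.1 (ht.mem a ha) ?_
  have e1 : c ∉ M a := ht.notMem hc ha hac.symm (ht.mem c hc)
  have e2 : c ∉ M b := ht.notMem hc hb hbc.symm (ht.mem c hc)
  have key : ∀ u, u ≠ a → (T.Adj a u ↔ T.Adj a c) := by
    intro u hu
    by_cases hua : u ∈ M a
    · exact h1.2.2.2.1 u (ht.notMem ha hb hab hua) c e2 hu hac.symm
    · exact h2.1 u hua c e1 a (fun h' => h' (ht.mem a ha))
  intro u _ v _ hu hv
  rw [key u hu, key v hv]

/-- The union of all three sets is a module meeting every comodule's representative, hence all of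
`V`. So `(M a)ᶜ` and `(M c)ᶜ` are modules. A third module `M a ∪ M c` would make each of `a`, `b`,
`c` see the others alike, and extremeness contradicts `not_isModule_compl`. -/
theorem not_union_union (ht : T.IsTransversal X M) {a b c : V} (ha : a ∈ X) (hb : b ∈ X)
    (hc : c ∈ X) (hab : a ≠ b) (hac : a ≠ c) (hbc : b ≠ c) (hX : ∀ x ∈ X, x = a ∨ x = b ∨ x = c)
    (h1 : T.IsModule (M a ∪ M b)) (h2 : T.IsModule (M b ∪ M c))
    (h3 : T.Obstructed a (M a) c (M c) ∨ T.Obstructed c (M c) a (M a)) : False := by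
  have ma := ht.mem a ha
  have mb := ht.mem b hb
  have mc := ht.mem c hc
  have hmod := h1.union h2 ⟨b, Or.inr mb, Or.inl mb⟩
  have huniv : (M a ∪ M b) ∪ (M b ∪ M c) = univ := by
    by_contra hne
    obtain ⟨x, hx, hx'⟩ := ht.hit _ (IsComodule.compl (Or.inl
      ⟨hmod, ⟨a, Or.inl (Or.inl ma), b, Or.inl (Or.inr mb), hab⟩, hne⟩))
    apply hx'
    rcases hX x hx with rfl | rfl | rfl
    · exact Or.inl (Or.inl ma)
    · exact Or.inl (Or.inr mb)
    · exact Or.inr (Or.inr mc)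
  have ca : M b ∪ M c = (M a)ᶜ := by
    ext u
    constructor
    · rintro (h | h)
      · exact ht.notMem hb ha hab.symm h
      · exact ht.notMem hc ha hac.symm h
    · intro h
      have : u ∈ (M a ∪ M b) ∪ (M b ∪ M c) := huniv ▸ mem_univ u
      have h' : u ∉ M a := h
      simp only [mem_union] at this ⊢
      tauto
  have cc : M a ∪ M b = (M c)ᶜ := by
    ext u
    constructor
    · rintro (h | h)
      · exact ht.notMem ha hc hac h
      · exact ht.notMem hb hc hbc h
    · intro h
      have : u ∈ (M a ∪ M b) ∪ (M b ∪ M c) := huniv ▸ mem_univ u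
      have h' : u ∉ M c := h
      simp only [mem_union] at this ⊢
      tauto
  rcases obstructed_cases h3 with h | h | h
  · have e1 := h a (Or.inl ma) c (Or.inr mc) b (by
      rintro (h' | h')
      · exact ht.notMem hb ha hab.symm mb h'
      · exact ht.notMem hb hc hbc mb h')
    have e2 := h2 b (Or.inl mb) c (Or.inr mc) a (by rw [ca]; exact fun h' => h' ma)
    have e3 := h1 a (Or.inl ma) b (Or.inr mb) c (by rw [cc]; exact fun h' => h' mc)
    have n1 := T.adj_iff a b hab
    have n2 := T.adj_iff a c hac
    have n3 := T.adj_iff b c hbc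
    grind only
  · obtain ⟨a', ha'⟩ := h.2.1
    exact (ht.isMin a ha).not_isModule_compl h.1 ha' (ca ▸ h2)
  · obtain ⟨c', hc'⟩ := h.2.1
    exact (ht.isMin c hc).not_isModule_compl h.1 hc' (cc ▸ h1)

/-- Here `b` and `c` are the two extremes of `(M a)ᶜ`, so any further vertex there would distinguish
them; hence `(M a)ᶜ = M b ∪ M c`. Their twins `b'`, `c'` then form a module avoiding `X`. -/
theorem not_extreme_extreme_union (ht : T.IsTransversal X M) {a b c : V} (ha : a ∈ X)
    (hb : b ∈ X) (hc : c ∈ X) (hab : a ≠ b) (hac : a ≠ c) (hbc : b ≠ c)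
    (hX : ∀ x ∈ X, x = a ∨ x = b ∨ x = c)
    (h1 : T.ObstructedExtreme b (M b) a (M a)) (h2 : T.ObstructedExtreme c (M c) a (M a))
    (h3 : T.IsModule (M b ∪ M c)) : False := by
  have ma := ht.mem a ha
  have mb := ht.mem b hb
  have mc := ht.mem c hc
  obtain ⟨hMb, ⟨b', hb'⟩, hNa, eb, -⟩ := h1
  obtain ⟨hMc, ⟨c', hc'⟩, -, ec, -⟩ := h2
  have bc : b ∉ M c := ht.notMem hb hc hbc mb
  have cb : c ∉ M b := ht.notMem hc hb hbc.symm mc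
  have ba : b ∉ M a := ht.notMem hb ha hab.symm mb
  have ca : c ∉ M a := ht.notMem hc ha hac.symm mc
  have mb' : b' ∈ M b := by simp [hb']
  have mc' : c' ∈ M c := by simp [hc']
  have b'a : b' ∉ M a := ht.notMem hb ha hab.symm mb'
  have c'a : c' ∉ M a := ht.notMem hc ha hac.symm mc'
  have b'c : b' ∉ M c := ht.notMem hb hc hbc mb'
  have c'b : c' ∉ M b := ht.notMem hc hb hbc.symm mc'
  have hbb' : b ≠ b' := by
    rintro rfl
    exact hMb.2.1.ne_singleton (by simpa using hb')
  have hcc' : c ≠ c' := by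
    rintro rfl
    exact hMc.2.1.ne_singleton (by simpa using hc')
  have hcov : ∀ w ∉ M a, w ∈ M b ∪ M c := by
    intro w hw
    by_contra hw'
    have hwb : w ≠ b := by rintro rfl; exact hw' (Or.inl mb)
    have hwc : w ≠ c := by rintro rfl; exact hw' (Or.inr mc)
    have e1 := h3 b (Or.inl mb) c (Or.inr mc) w hw'
    have e2 := eb w hw c ca hwb hbc.symm
    have e3 := ec w hw b ba hwc hbc
    have n1 := T.adj_iff b c hbc
    have n2 := T.adj_iff w b hwb
    have n3 := T.adj_iff w c hwc
    grind only
  have key : ∀ v ∉ ({b', c'} : Set V), (T.Adj v b' ↔ T.Adj v c') := by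
    intro v hv
    simp only [mem_insert_iff, mem_singleton_iff, not_or] at hv
    by_cases hva : v ∈ M a
    · exact hNa.1 b' b'a c' c'a v (fun h' => h' hva)
    · rcases hcov v hva with h | h
      · rw [hb'] at h
        obtain rfl : v = b := h.resolve_right hv.1
        exact eb b' b'a c' c'a hbb'.symm (by rintro rfl; exact c'b mb)
      · rw [hc'] at h
        obtain rfl : v = c := h.resolve_right hv.2
        exact ec b' b'a c' c'a (by rintro rfl; exact b'c mc) hcc'.symm
  have hmod : T.IsModule {b', c'} := by
    rintro u (rfl | rfl) w (rfl | rfl) v hv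
    · rfl
    · exact key v hv
    · exact (key v hv).symm
    · rfl
  have hbc' : b' ≠ c' := by
    rintro rfl
    exact b'c mc'
  obtain ⟨x, hx, hx'⟩ := ht.hit {b', c'} (Or.inl ⟨hmod, ⟨b', by simp, c', by simp, hbc'⟩, by
    intro h'
    have : b ∈ ({b', c'} : Set V) := h' ▸ mem_univ b
    rcases this with h | h
    · exact hbb' h
    · exact bc (by rw [h]; exact mc')⟩)
  rcases hX x hx with rfl | rfl | rfl <;> rcases hx' with h | h
  · exact b'a (h ▸ ma)
  · exact c'a (h ▸ ma)
  · exact hbb' h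
  · exact c'b (h ▸ mb)
  · exact b'c (h ▸ mc)
  · exact hcc' h

/-- In a transversal with three elements some pair is not obstructed. -/
theorem exists_not_obstructed (ht : T.IsTransversal X M) {a b c : V} (ha : a ∈ X)
    (hb : b ∈ X) (hc : c ∈ X) (hab : a ≠ b) (hac : a ≠ c) (hbc : b ≠ c)
    (hX : ∀ x ∈ X, x = a ∨ x = b ∨ x = c)
    (h1 : T.Obstructed a (M a) b (M b) ∨ T.Obstructed b (M b) a (M a))
    (h2 : T.Obstructed a (M a) c (M c) ∨ T.Obstructed c (M c) a (M a))
    (h3 : T.Obstructed b (M b) c (M c) ∨ T.Obstructed c (M c) b (M b)) : False := by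
  have hba := hab.symm
  have hca := hac.symm
  have hcb := hbc.symm
  have hX1 : ∀ x ∈ X, x = a ∨ x = c ∨ x = b := fun x hx => by have := hX x hx; tauto
  have hX2 : ∀ x ∈ X, x = b ∨ x = a ∨ x = c := fun x hx => by have := hX x hx; tauto
  have hX3 : ∀ x ∈ X, x = c ∨ x = a ∨ x = b := fun x hx => by have := hX x hx; tauto
  have u1 := ht.not_union_union ha hb hc hab hac hbc hX
  have u2 := ht.not_union_union ha hc hb hac hab hcb hX1
  have u3 := ht.not_union_union hb ha hc hba hbc hac hX2
  rw [union_comm (M c) (M b)] at u2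
  rw [union_comm (M b) (M a)] at u3
  have e1 := ht.not_extreme_extreme ha hb hc hab hac hbc
  have e2 := ht.not_extreme_extreme hb ha hc hba hbc hac
  have e3 := ht.not_extreme_extreme hc ha hb hca hcb hab
  have f1 := fun g1 g2 => ht.not_extreme_of_compl ha hb hc hab hac hbc g1
    (g2 : T.ObstructedExtreme c (M c) a (M a)).2.2.1
  have f2 := fun g1 g2 => ht.not_extreme_of_compl ha hc hb hac hab hcb g1
    (g2 : T.ObstructedExtreme b (M b) a (M a)).2.2.1
  have f3 := fun g1 g2 => ht.not_extreme_of_compl hb ha hc hba hbc hac g1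
    (g2 : T.ObstructedExtreme c (M c) b (M b)).2.2.1
  have f4 := fun g1 g2 => ht.not_extreme_of_compl hb hc ha hbc hba hca g1
    (g2 : T.ObstructedExtreme a (M a) b (M b)).2.2.1
  have f5 := fun g1 g2 => ht.not_extreme_of_compl hc ha hb hca hcb hab g1
    (g2 : T.ObstructedExtreme b (M b) c (M c)).2.2.1
  have f6 := fun g1 g2 => ht.not_extreme_of_compl hc hb ha hcb hca hba g1
    (g2 : T.ObstructedExtreme a (M a) c (M c)).2.2.1
  have g1 := ht.not_extreme_extreme_union ha hb hc hab hac hbc hX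
  have g2 := ht.not_extreme_extreme_union hb ha hc hba hbc hac hX2
  have g3 := ht.not_extreme_extreme_union hc ha hb hca hcb hab hX3
  have k1 := obstructed_cases h1
  have k2 := obstructed_cases h2
  have k3 := obstructed_cases h3
  -- Each pair is a union or an arrow from its extreme vertex. Two unions, two arrows out of one
  -- vertex, and a directed path are excluded, as are two arrows into one vertex opposite a union.
  -- Every one of the 27 cases contains one of these.
  rcases k1 with k1 | k1 | k1 <;> rcases k2 with k2 | k2 | k2 <;> rcases k3 with k3 | k3 | k3 <;>
    first
    | exact u1 k1 k3 h2
    | exact u2 k2 k3 h1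
    | exact u3 k1 k2 h3
    | exact e1 k1 k2
    | exact e2 k1 k3
    | exact e3 k2 k3
    | exact f1 k1 k2
    | exact f2 k2 k1
    | exact f3 k1 k3
    | exact f4 k3 k1
    | exact f5 k2 k3
    | exact f6 k3 k2
    | exact g1 k1 k2 k3
    | exact g2 k1 k3 k2
    | exact g3 k2 k3 k1

/-- A tournament in which no three comodules are pairwise disjoint becomes indecomposable by
the reversal of at most one arc. -/
theorem exists_of_le_two [Finite V] (hV : 5 ≤ Nat.card V)
    (h : ∀ D E F, T.IsComodule D → T.IsComodule E → T.IsComodule F → Disjoint D E →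
      Disjoint D F → Disjoint E F → False) :
    ∃ T' : Tournament V, T'.IsIndecomposable ∧ (T.reversedArcs T').ncard ≤ 1 := by
  obtain ⟨X, M, ht⟩ := T.exists_isTransversal
  by_cases hind : T.IsIndecomposable
  · refine ⟨T, hind, ?_⟩
    have : T.reversedArcs T = ∅ := by
      ext a
      simp only [reversedArcs, mem_ofPred_eq, mem_empty_iff_false, iff_false, not_and]
      exact fun h => adj_asymm h
    simp [this]
  · rw [isIndecomposable_iff] at hind
    push Not at hind
    obtain ⟨K, hK⟩ := hind
    have hK : T.IsComodule K := Or.inl hK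
    obtain ⟨x, hx, hxK⟩ := ht.hit _ hK
    obtain ⟨y, hy, hyK⟩ := ht.hit _ hK.compl
    have hxy : x ≠ y := by
      rintro rfl
      exact hyK hxK
    have hX : X = {x, y} := by
      ext z
      constructor
      · intro hz
        by_contra hne
        simp only [mem_insert_iff, mem_singleton_iff, not_or] at hne
        exact h _ _ _ (ht.isMin x hx).prop (ht.isMin y hy).prop (ht.isMin z hz).prop
          (ht.disjoint x hx y hy hxy) (ht.disjoint x hx z hz (Ne.symm hne.1))
          (ht.disjoint y hy z hz (Ne.symm hne.2))
      · rintro (rfl | rfl) <;> assumption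
    exact exists_of_two hV hxy (hX ▸ ht)

/-- Reverse the arc of an unobstructed pair `x`, `y`. Every remaining comodule contains both `x` and
`y`, or else `z`, so no three are disjoint and one more reversal suffices. -/
theorem exists_of_three [Finite V] (hV : 5 ≤ Nat.card V) (ht : T.IsTransversal X M)
    (hX : X.ncard = 3) :
    ∃ T' : Tournament V, T'.IsIndecomposable ∧ (T.reversedArcs T').ncard ≤ 2 := by
  classical
  have main : ∀ x ∈ X, ∀ y ∈ X, ∀ z, x ≠ y → (∀ u ∈ X, u = x ∨ u = y ∨ u = z) →
      ¬ (T.Obstructed x (M x) y (M y) ∨ T.Obstructed y (M y) x (M x)) →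
      ∃ T' : Tournament V, T'.IsIndecomposable ∧ (T.reversedArcs T').ncard ≤ 2 := by
    intro x hx y hy z hxy hX hob
    rw [not_or] at hob
    set T₁ := T.flip (Equiv.swap x y) (isPairing_swap hxy).1 with hT₁
    have hc : ∀ K, T₁.IsNontrivialModule K → T.IsComodule K ∧ (x ∈ K ↔ y ∈ K) := by
      intro K hK
      have hc := ht.not_covers_of_swap hxy hx hy hob.1 hob.2 hK
      have hinv : ∀ u ∈ K, Equiv.swap x y u ∈ K := by
        intro u hu
        by_contra h'
        exact hc ⟨u, hu, h'⟩
      exact ⟨Or.inl (hK.of_flip hinv), fun h => by simpa using hinv x h,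
        fun h => by simpa using hinv y h⟩
    have hco : ∀ D, T₁.IsComodule D → (x ∈ D ∨ z ∈ D) ∧ (x ∈ D ↔ y ∈ D) := by
      intro D hD
      have h1 : T.IsComodule D ∧ (x ∈ D ↔ y ∈ D) := by
        rcases hD with hD | hD
        · exact hc D hD
        · obtain ⟨h1, h2⟩ := hc _ hD
          have := h1.compl
          rw [compl_compl] at this
          exact ⟨this, not_iff_not.mp h2⟩
      obtain ⟨u, hu, huD⟩ := ht.hit D h1.1
      refine ⟨?_, h1.2⟩
      rcases hX u hu with rfl | rfl | rfl <;> tauto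
    obtain ⟨T', h1, h2⟩ := exists_of_le_two (T := T₁) hV (by
      intro D E F hD hE hF h1 h2 h3
      have d1 := hco D hD
      have d2 := hco E hE
      have d3 := hco F hF
      rw [disjoint_left] at h1 h2 h3
      have a1 := @h1 x
      have a2 := @h2 x
      have a3 := @h3 x
      have b1 := @h1 z
      have b2 := @h2 z
      have b3 := @h3 z
      tauto)
    refine ⟨T', h1, ?_⟩
    have := (isPairing_swap hxy).ncard_reversedArcs (T := T)
    rw [ncard_pair hxy, ← hT₁] at this
    have := ncard_reversedArcs_le T T₁ T'
    omega
  obtain ⟨a, b, c, hab, hac, hbc, rfl⟩ := ncard_eq_three.mp hX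
  have hX : ∀ u ∈ ({a, b, c} : Set V), u = a ∨ u = b ∨ u = c := fun u hu => hu
  by_cases h1 : T.Obstructed a (M a) b (M b) ∨ T.Obstructed b (M b) a (M a)
  · by_cases h2 : T.Obstructed a (M a) c (M c) ∨ T.Obstructed c (M c) a (M a)
    · by_cases h3 : T.Obstructed b (M b) c (M c) ∨ T.Obstructed c (M c) b (M b)
      · exact (ht.exists_not_obstructed (by simp) (by simp) (by simp) hab hac hbc hX
          h1 h2 h3).elim
      · exact main b (by simp) c (by simp) a hbc (fun u hu => by have := hX u hu; tauto) h3
    · exact main a (by simp) c (by simp) b hac (fun u hu => by have := hX u hu; tauto) h2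
  · exact main a (by simp) b (by simp) c hab hX h1

/-- A tournament with a transversal of `k` elements becomes indecomposable by the reversal of at
most `⌈k / 2⌉` arcs. -/
theorem exists_isIndecomposable [Finite V] (hV : 5 ≤ Nat.card V) (ht : T.IsTransversal X M) :
    ∃ T' : Tournament V, T'.IsIndecomposable ∧ 2 * (T.reversedArcs T').ncard ≤ X.ncard + 1 := by
  by_cases hsmall : X.ncard ≤ 2
  · by_cases h0 : T.IsIndecomposable
    · refine ⟨T, h0, ?_⟩
      have : T.reversedArcs T = ∅ := by
        ext a
        simp only [reversedArcs, mem_ofPred_eq, mem_empty_iff_false, iff_false, not_and]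
        exact fun h => adj_asymm h
      simp [this]
    · rw [isIndecomposable_iff] at h0
      push Not at h0
      obtain ⟨K, hK⟩ := h0
      have hK : T.IsComodule K := Or.inl hK
      obtain ⟨x, hx, hxK⟩ := ht.hit _ hK
      obtain ⟨y, hy, hyK⟩ := ht.hit _ hK.compl
      have hxy : x ≠ y := by
        rintro rfl
        exact hyK hxK
      have hX : {x, y} = X := eq_of_subset_of_ncard_le
        (by rintro _ (rfl | rfl) <;> assumption) (by rw [ncard_pair hxy]; exact hsmall)
      obtain ⟨T', h1, h2⟩ := exists_of_two hV hxy (hX ▸ ht)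
      rw [← hX, ncard_pair hxy]
      exact ⟨T', h1, by omega⟩
  by_cases h3 : X.ncard = 3
  · obtain ⟨T', h1, h2⟩ := exists_of_three hV ht h3
    exact ⟨T', h1, by omega⟩
  rcases Nat.even_or_odd X.ncard with hev | hodd
  · obtain ⟨σ, hσ, hc⟩ := T.exists_covering_pairing hev
    refine ⟨T.flip σ hσ.1, ?_, by have := hσ.ncard_reversedArcs (T := T); omega⟩
    rw [isIndecomposable_iff]
    intro K hK
    have hnc := ht.not_covers_of_flip hσ Subset.rfl (by omega) hc hK
    have hinv : ∀ u ∈ K, σ u ∈ K := by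
      intro u hu
      by_contra h'
      exact hnc ⟨u, hu, h'⟩
    have hKT : T.IsComodule K := Or.inl (hK.of_flip hinv)
    obtain ⟨x, hx, hxK⟩ := ht.hit _ hKT
    obtain ⟨y, hy, hyK⟩ := ht.hit _ hKT.compl
    exact hc K hKT hnc ⟨x, hxK, hx⟩ ⟨y, hyK, hy⟩
  -- For odd `|X| ≥ 5` one element `f` is left unpaired and a further reversal finishes.
  · obtain ⟨f, hf⟩ : X.Nonempty := by
      rw [← ncard_pos]
      exact hodd.pos
    have hcard := ncard_sdiff_singleton_add_one hf
    have hev : Even (X \ {f}).ncard := by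
      rw [← hcard, Nat.odd_add_one, Nat.not_odd_iff_even] at hodd
      exact hodd
    obtain ⟨σ, hσ, hc⟩ := T.exists_covering_pairing hev
    have hfour : 4 ≤ (X \ {f}).ncard := by
      have : X.ncard ≠ 4 := by
        intro h
        rw [h] at hodd
        exact absurd hodd (by decide)
      omega
    have hmod : ∀ K, (T.flip σ hσ.1).IsNontrivialModule K → T.IsComodule K ∧ ¬ Covers σ K := by
      intro K hK
      have hnc := ht.not_covers_of_flip hσ sdiff_subset hfour hc hK
      refine ⟨Or.inl (hK.of_flip ?_), hnc⟩
      intro u hu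
      by_contra h'
      exact hnc ⟨u, hu, h'⟩
    have hcom : ∀ K, (T.flip σ hσ.1).IsComodule K → T.IsComodule K ∧ ¬ Covers σ K := by
      rintro K (hK | hK)
      · exact hmod K hK
      · obtain ⟨h1, h2⟩ := hmod _ hK
        refine ⟨compl_compl K ▸ h1.compl, fun h => h2 (h.compl hσ.1)⟩
    obtain ⟨g, hg⟩ : (X \ {f}).Nonempty := by
      rw [← ncard_pos]
      omega
    -- A remaining comodule without `f` meets `X \ {f}` and, being uncovered, contains all of it, in
    -- particular `g`. Hence no three are disjoint.
    have hsplit : ∀ K, (T.flip σ hσ.1).IsComodule K → f ∈ K ∨ g ∈ K := by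
      intro K hK
      obtain ⟨h1, h2⟩ := hcom K hK
      by_contra hcon
      rw [not_or] at hcon
      obtain ⟨x, hx, hxK⟩ := ht.hit K h1
      exact hc K h1 h2 ⟨x, hxK, hx, by rintro rfl; exact hcon.1 hxK⟩ ⟨g, hcon.2, hg⟩
    obtain ⟨T', h1, h2⟩ := exists_of_le_two (T := T.flip σ hσ.1) hV (by
      intro D E F hD hE hF h1 h2 h3
      have d1 := hsplit D hD
      have d2 := hsplit E hE
      have d3 := hsplit F hF
      rw [disjoint_left] at h1 h2 h3
      have a1 := @h1 f
      have a2 := @h2 f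
      have a3 := @h3 f
      have b1 := @h1 g
      have b2 := @h2 g
      have b3 := @h3 g
      tauto)
    refine ⟨T', h1, ?_⟩
    have := hσ.ncard_reversedArcs (T := T)
    have := ncard_reversedArcs_le T (T.flip σ hσ.1) T'
    omega

end IsTransversal

end Three

/-! ### Disjoint comodules bound the index from below -/

section LowerBound

variable {V : Type*} {T : Tournament V}

/-- Reversing arcs none of which leaves or enters `D` preserves that `D` is a module. -/
theorem IsModule.inv {B : Set (V × V)} {hB : B ⊆ T.arcs} {D : Set V} (hD : T.IsModule D)
    (h : ∀ a ∈ B, a.1 ∈ D ↔ a.2 ∈ D) : (T.inv B hB).IsModule D := by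
  have key : ∀ x ∈ D, ∀ v ∉ D, ((T.inv B hB).Adj v x ↔ T.Adj v x) := by
    intro x hx v hv
    have h1 : (v, x) ∉ B := fun h' => hv ((h _ h').mpr hx)
    have h2 : (x, v) ∉ B := fun h' => hv ((h _ h').mp hx)
    change (v, x) ∈ (T.arcs \ B) ∪ Prod.swap ⁻¹' B ↔ _
    simp [h1, h2, arcs]
  intro x hx y hy v hv
  rw [key x hx v hv, key y hy v hv]
  exact hD x hx y hy v hv

/-- Every `D i` must contain an end of a reversed arc, or it would survive. Disjoint sets use
distinct ends, and `B` has at most `2 * B.card` of them. -/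
theorem card_le_of_inv_isIndecomposable [Finite V] {ι : Type*} {D : ι → Set V}
    (hD : ∀ i, T.IsComodule (D i)) (hd : ∀ i j, i ≠ j → Disjoint (D i) (D j))
    {B : Finset (V × V)} {hB : (B : Set (V × V)) ⊆ T.arcs}
    (h : (T.inv B hB).IsIndecomposable) : Nat.card ι ≤ 2 * B.card := by
  have hex : ∀ i, ∃ p ∈ D i, p ∈ Prod.fst '' (B : Set (V × V)) ∪ Prod.snd '' (B : Set (V × V)) := by
    intro i
    by_contra hcon
    push Not at hcon
    have hinv : ∀ a ∈ (B : Set (V × V)), a.1 ∈ D i ↔ a.2 ∈ D i := by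
      intro a ha
      exact ⟨fun h' => (hcon _ h' (Or.inl ⟨a, ha, rfl⟩)).elim,
        fun h' => (hcon _ h' (Or.inr ⟨a, ha, rfl⟩)).elim⟩
    rw [isIndecomposable_iff] at h
    rcases hD i with h1 | h1
    · exact h _ ⟨h1.1.inv hinv, h1.2⟩
    · exact h _ ⟨h1.1.inv fun a ha => not_iff_not.mpr (hinv a ha), h1.2⟩
  choose p hp hp' using hex
  have hinj : Function.Injective p := by
    intro i j hij
    by_contra hne
    exact disjoint_left.mp (hd i j hne) (hp i) (hij ▸ hp j)
  have h1 : Nat.card ι ≤ (Prod.fst '' (B : Set (V × V)) ∪ Prod.snd '' (B : Set (V × V))).ncard := by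
    rw [← ncard_range_of_injective hinj]
    exact ncard_le_ncard (range_subset_iff.mpr hp')
  have h2 := ncard_union_le (Prod.fst '' (B : Set (V × V))) (Prod.snd '' (B : Set (V × V)))
  have h3 : (Prod.fst '' (B : Set (V × V))).ncard ≤ (B : Set (V × V)).ncard := ncard_image_le
  have h4 : (Prod.snd '' (B : Set (V × V))).ncard ≤ (B : Set (V × V)).ncard := ncard_image_le
  rw [ncard_coe_finset] at h3 h4
  omega

theorem card_le_two_mul_decompIndex [Finite V] (hV : 5 ≤ Nat.card V) {ι : Type*} {D : ι → Set V}
    (hD : ∀ i, T.IsComodule (D i)) (hd : ∀ i j, i ≠ j → Disjoint (D i) (D j)) :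
    Nat.card ι ≤ 2 * T.decompIndex := by
  obtain ⟨X, M, ht⟩ := T.exists_isTransversal
  obtain ⟨T', hT', -⟩ := ht.exists_isIndecomposable hV
  obtain ⟨B, hB, -, h⟩ := exists_inv_isIndecomposable (T := T) hT'
  -- The infimum is attained only because the set is nonempty, which the upper bound supplies; `sInf
  -- ∅ = 0` would be useless here.
  obtain ⟨B', hB', hc, h'⟩ := Nat.sInf_mem (s := {m | ∃ (B : Finset (V × V))
    (hB : (B : Set (V × V)) ⊆ T.arcs), B.card = m ∧ (T.inv B hB).IsIndecomposable})
    ⟨_, B, hB, rfl, h⟩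
  have := card_le_of_inv_isIndecomposable hD hd h'
  rwa [hc] at this

end LowerBound

/-! ### The size of a transversal -/

section Count

variable {V : Type*} {T : Tournament V} {X : Set V} {M : V → Set V}

theorem IsTransversal.extreme_of_singleton (ht : T.IsTransversal X M) {x : V} (hx : x ∈ X)
    (h : M x = {x}) : ∀ u v, u ≠ x → v ≠ x → (T.Adj x u ↔ T.Adj x v) := by
  intro u v hu hv
  rcases (ht.isMin x hx).prop with h' | h'
  · rw [h] at h'
    exact (h'.2.1.ne_singleton rfl).elim
  · rw [h] at h'
    exact h'.1 u hu v hv x (fun h => h rfl)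

/-- Three such vertices would each see the other two alike, which is impossible. -/
theorem IsTransversal.ncard_singletons_le [Finite V] (ht : T.IsTransversal X M) :
    {x | x ∈ X ∧ M x = {x}}.ncard ≤ 2 := by
  by_contra hcon
  push Not at hcon
  obtain ⟨a, b, c, ha, hb, hc, hab, hac, hbc⟩ := (two_lt_ncard_iff (toFinite _)).mp hcon
  have e1 := ht.extreme_of_singleton ha.1 ha.2 b c hab.symm hac.symm
  have e2 := ht.extreme_of_singleton hb.1 hb.2 a c hab hbc.symm
  have e3 := ht.extreme_of_singleton hc.1 hc.2 a b hac hbc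
  have n1 := T.adj_iff a b hab
  have n2 := T.adj_iff a c hac
  have n3 := T.adj_iff b c hbc
  grind only

theorem IsTransversal.ncard_ge_two (ht : T.IsTransversal X M) [Finite V] {x : V} (hx : x ∈ X)
    (h : M x ≠ {x}) : 2 ≤ (M x).ncard := by
  by_contra hlt
  have hpos : 0 < (M x).ncard := (ncard_pos (toFinite _)).mpr ⟨x, ht.mem x hx⟩
  obtain ⟨a, ha⟩ := ncard_eq_one.mp (show (M x).ncard = 1 by omega)
  have := ht.mem x hx
  rw [ha] at this
  have : x = a := this
  rw [this] at h ha
  exact h ha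

theorem IsTransversal.sum_ncard_le [Fintype V] [DecidableEq V] (ht : T.IsTransversal X M)
    (F : Finset V) (hF : (F : Set V) = X) : ∑ x ∈ F, (M x).ncard ≤ Nat.card V := by
  classical
  have h1 : ∀ x ∈ F, (M x).ncard = (M x).toFinset.card := fun x _ => ncard_eq_toFinset_card' _
  rw [Finset.sum_congr rfl h1, ← Finset.card_biUnion, Nat.card_eq_fintype_card]
  · exact Finset.card_le_univ _
  · intro x hx y hy hxy
    exact Set.disjoint_toFinset.mpr (ht.disjoint x (hF ▸ hx) y (hF ▸ hy) hxy)

/-- A transversal has at most `⌊|V| / 2⌋ + 1` elements, and in the case of equality for an even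
`|V|` it consists of a source, a sink, and representatives of pairs of twins. -/
theorem IsTransversal.ncard_bound [Finite V] (ht : T.IsTransversal X M) :
    2 * X.ncard ≤ Nat.card V + 2 ∧ (2 * X.ncard = Nat.card V + 2 →
      {x | x ∈ X ∧ M x = {x}}.ncard = 2 ∧ ∀ x ∈ X, M x ≠ {x} → (M x).ncard = 2) := by
  classical
  have := Fintype.ofFinite V
  let F := X.toFinset
  have hF : (F : Set V) = X := coe_toFinset X
  have hmemF : ∀ x, x ∈ F ↔ x ∈ X := fun x => mem_toFinset
  have hcard : X.ncard = F.card := ncard_eq_toFinset_card' X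
  have hsum := ht.sum_ncard_le F hF
  -- Adding one for each singleton makes every weight at least two, while the total is at most `|V|
  -- + 2`. Equality therefore forces every weight to be exactly two.
  let g : V → ℕ := fun x => (M x).ncard + if M x = {x} then 1 else 0
  have hS : ∑ x ∈ F, (if M x = {x} then 1 else 0) = {x | x ∈ X ∧ M x = {x}}.ncard := by
    rw [← Finset.card_filter, ← ncard_coe_finset]
    congr 1
    ext x
    simp [hmemF]
  have hle : ∀ x ∈ F, 2 ≤ g x := by
    intro x hx
    by_cases h : M x = {x}
    · simp [g, h]
    · have := ht.ncard_ge_two ((hmemF x).mp hx) h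
      simpa [g, h] using this
  have hg : ∑ x ∈ F, g x = ∑ x ∈ F, (M x).ncard + {x | x ∈ X ∧ M x = {x}}.ncard := by
    rw [← hS, ← Finset.sum_add_distrib]
  have h2 := ht.ncard_singletons_le
  have hge := Finset.sum_le_sum hle
  have hconst : ∑ _x ∈ F, 2 = 2 * X.ncard := by
    rw [Finset.sum_const, hcard, smul_eq_mul, mul_comm]
  refine ⟨by omega, fun heq => ⟨by omega, ?_⟩⟩
  intro x hx hne
  have := (Finset.sum_eq_sum_iff_of_le hle).mp (by omega) x ((hmemF x).mpr hx)
  simpa [g, hne] using this.symm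

end Count

/-! ### Coordinates and arcs of the extremal tournaments -/

section Target

/-- The tournament `3(1, S.2, 1)`. -/
abbrev twinSum {m : ℕ} (S : Tournament (Fin m)) :=
  (transitive 3).lexSum₃ (transitive 1) (S.lexProd (transitive 2)) (transitive 1)

/-- The vertex set of `3(1, S.2, 1)`. -/
abbrev TwinVertex (m : ℕ) := Σ i, triple (Fin 1) (Σ _ : Fin m, Fin 2) (Fin 1) i

variable {m : ℕ}

/-- The vertex set of `3(1, S.2, 1)` as a direct sum. -/
def twinVertexEquiv (m : ℕ) : TwinVertex m ≃ Fin 1 ⊕ ((Σ _ : Fin m, Fin 2) ⊕ Fin 1) where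
  toFun
    | ⟨0, a⟩ => Sum.inl a
    | ⟨1, a⟩ => Sum.inr (Sum.inl a)
    | ⟨2, a⟩ => Sum.inr (Sum.inr a)
  invFun
    | Sum.inl a => ⟨0, a⟩
    | Sum.inr (Sum.inl a) => ⟨1, a⟩
    | Sum.inr (Sum.inr a) => ⟨2, a⟩
  left_inv := by
    rintro ⟨i, a⟩
    fin_cases i <;> rfl
  right_inv := by
    rintro (a | a | a) <;> rfl

instance : Finite (TwinVertex m) := Finite.of_equiv _ (twinVertexEquiv m).symm

theorem card_twinVertex (m : ℕ) : Nat.card (TwinVertex m) = 2 * m + 2 := by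
  rw [Nat.card_congr (twinVertexEquiv m)]
  simp
  ring

/-- The source of `3(1, S.2, 1)`. -/
def twinBot : TwinVertex m := ⟨0, (0 : Fin 1)⟩

/-- The sink of `3(1, S.2, 1)`. -/
def twinTop : TwinVertex m := ⟨2, (0 : Fin 1)⟩

/-- A vertex in the middle part of `3(1, S.2, 1)`. -/
def twinMid (i : Fin m) (a : Fin 2) : TwinVertex m := ⟨1, (⟨i, a⟩ : Σ _ : Fin m, Fin 2)⟩

theorem twinVertex_cases {P : TwinVertex m → Prop} (h0 : P twinBot) (h1 : ∀ i a, P (twinMid i a))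
    (h2 : P twinTop) (x : TwinVertex m) : P x := by
  obtain ⟨i, a⟩ := x
  match i, a with
  | 0, a =>
    obtain rfl : a = (0 : Fin 1) := Subsingleton.elim (α := Fin 1) _ _
    exact h0
  | 1, ⟨i, a⟩ => exact h1 i a
  | 2, a =>
    obtain rfl : a = (0 : Fin 1) := Subsingleton.elim (α := Fin 1) _ _
    exact h2

variable (S : Tournament (Fin m))

theorem twinSum_bot_mid (i : Fin m) (a : Fin 2) : (twinSum S).Adj twinBot (twinMid i a) :=
  Sigma.Lex.left _ _ (by decide : (0 : Fin 3) < 1)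

theorem twinSum_bot_top : (twinSum S).Adj twinBot twinTop :=
  Sigma.Lex.left _ _ (by decide : (0 : Fin 3) < 2)

theorem twinSum_mid_top (i : Fin m) (a : Fin 2) : (twinSum S).Adj (twinMid i a) twinTop :=
  Sigma.Lex.left _ _ (by decide : (1 : Fin 3) < 2)

theorem twinSum_mid_mid (i j : Fin m) (a b : Fin 2) :
    (twinSum S).Adj (twinMid i a) (twinMid j b) ↔ S.Adj i j ∨ (i = j ∧ a < b) := by
  constructor
  · intro h
    rcases h with ⟨_, _, h⟩ | ⟨_, _, h⟩
    · exact (lt_irrefl (1 : Fin 3) h).elim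
    · rcases h with ⟨_, _, h⟩ | ⟨_, _, h⟩
      · exact Or.inl h
      · exact Or.inr ⟨rfl, h⟩
  · rintro (h | ⟨rfl, h⟩)
    · exact Sigma.Lex.right _ _ (Sigma.Lex.left _ _ h)
    · exact Sigma.Lex.right _ _ (Sigma.Lex.right _ _ h)

end Target

/-! ### Disjoint comodules of the extremal tournaments -/

section TargetModules

variable {m : ℕ} (S : Tournament (Fin m))

/-- The blocks of `3(1, S.2, 1)`: the source, the sink, and the twin pairs. -/
def twinBlock : Fin m ⊕ Bool → Set (TwinVertex m)
  | Sum.inl i => {twinMid i 0, twinMid i 1}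
  | Sum.inr true => {twinTop}
  | Sum.inr false => {twinBot}

theorem twinMid_injective {i j : Fin m} {a b : Fin 2} (h : twinMid i a = twinMid j b) :
    i = j ∧ a = b := by
  have h' : (⟨i, a⟩ : Σ _ : Fin m, Fin 2) = ⟨j, b⟩ :=
    eq_of_heq (Sigma.mk.inj h).2
  cases h'
  exact ⟨rfl, rfl⟩

theorem twinBot_ne_mid {i : Fin m} {a : Fin 2} : twinBot ≠ twinMid i a := by
  intro h
  exact absurd (Sigma.mk.inj h).1 (by decide)

theorem twinTop_ne_mid {i : Fin m} {a : Fin 2} : twinTop ≠ twinMid i a := by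
  intro h
  exact absurd (Sigma.mk.inj h).1 (by decide)

theorem twinBot_ne_top : (twinBot : TwinVertex m) ≠ twinTop := by
  intro h
  exact absurd (Sigma.mk.inj h).1 (by decide)

theorem disjoint_twinBlock (i j : Fin m ⊕ Bool) (hij : i ≠ j) :
    Disjoint (twinBlock i) (twinBlock j) := by
  rw [disjoint_left]
  intro x hx hy
  rcases i with i | (_ | _) <;> rcases j with j | (_ | _) <;>
    simp only [twinBlock, mem_insert_iff, mem_singleton_iff] at hx hy
  · apply hij
    rcases hx with rfl | rfl <;> rcases hy with h | h <;> rw [(twinMid_injective h).1]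
  · subst hy
    rcases hx with h | h <;> exact twinBot_ne_mid h
  · subst hy
    rcases hx with h | h <;> exact twinTop_ne_mid h
  · subst hx
    rcases hy with h | h <;> exact twinBot_ne_mid h
  · exact hij rfl
  · exact twinBot_ne_top (hx.symm.trans hy)
  · subst hx
    rcases hy with h | h <;> exact twinTop_ne_mid h
  · exact twinBot_ne_top (hy.symm.trans hx)
  · exact hij rfl

/-- Twin pairs are modules; for the source and the sink it is the complement, nontrivial because `0
< m` provides a twin pair inside it. -/
theorem isComodule_twinBlock (hm : 0 < m) (i : Fin m ⊕ Bool) :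
    (twinSum S).IsComodule (twinBlock i) := by
  have h01 : ∀ i : Fin m, twinMid i 0 ≠ twinMid i 1 := fun i h =>
    absurd (twinMid_injective h).2 (by decide)
  let i₀ : Fin m := ⟨0, hm⟩
  have hbot : ∀ x : TwinVertex m, x ≠ twinBot → (twinSum S).Adj twinBot x := by
    apply twinVertex_cases
    · exact fun h => (h rfl).elim
    · exact fun i a _ => twinSum_bot_mid S i a
    · exact fun _ => twinSum_bot_top S
  have htop : ∀ x : TwinVertex m, x ≠ twinTop → (twinSum S).Adj x twinTop := by
    apply twinVertex_cases
    · exact fun _ => twinSum_bot_top S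
    · exact fun i a _ => twinSum_mid_top S i a
    · exact fun h => (h rfl).elim
  rcases i with i | (_ | _)
  · left
    refine ⟨?_, ⟨_, Or.inl rfl, _, Or.inr rfl, h01 i⟩, ?_⟩
    · have key : ∀ v ∉ twinBlock (Sum.inl i),
          ((twinSum S).Adj v (twinMid i 0) ↔ (twinSum S).Adj v (twinMid i 1)) := by
        apply twinVertex_cases
        · exact fun _ => iff_of_true (twinSum_bot_mid S i 0) (twinSum_bot_mid S i 1)
        · intro j a hj
          have hji : j ≠ i := by
            rintro rfl
            apply hj
            fin_cases a
            · exact Or.inl rfl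
            · exact Or.inr rfl
          rw [twinSum_mid_mid, twinSum_mid_mid]
          simp [hji]
        · exact fun _ => iff_of_false (adj_asymm (twinSum_mid_top S i 0))
            (adj_asymm (twinSum_mid_top S i 1))
      rintro x (rfl | rfl) y (rfl | rfl) v hv
      · rfl
      · exact key v hv
      · exact (key v hv).symm
      · rfl
    · intro h
      have : twinBot ∈ twinBlock (Sum.inl i) := h ▸ mem_univ _
      rcases this with h | h <;> exact twinBot_ne_mid h
  · right
    refine ⟨?_, ⟨twinMid i₀ 0, twinBot_ne_mid.symm, twinMid i₀ 1, twinBot_ne_mid.symm, h01 i₀⟩, ?_⟩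
    · intro x hx y hy v hv
      obtain rfl : v = twinBot := not_not.mp hv
      exact iff_of_true (hbot x hx) (hbot y hy)
    · intro h
      have : twinBot ∈ (twinBlock (Sum.inr false))ᶜ := h ▸ mem_univ (twinBot : TwinVertex m)
      exact this rfl
  · right
    refine ⟨?_, ⟨twinMid i₀ 0, twinTop_ne_mid.symm, twinMid i₀ 1, twinTop_ne_mid.symm, h01 i₀⟩, ?_⟩
    · intro x hx y hy v hv
      obtain rfl : v = twinTop := not_not.mp hv
      exact iff_of_false (adj_asymm (htop x hx)) (adj_asymm (htop y hy))
    · intro h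
      have : twinTop ∈ (twinBlock (Sum.inr true))ᶜ := h ▸ mem_univ (twinTop : TwinVertex m)
      exact this rfl

end TargetModules

/-! ### Recognition of the extremal tournaments and the value of the maximum -/

section Isomorphism

variable {V W : Type*} {T : Tournament V} {U : Tournament W}

theorem IsNontrivialModule.preimage (f : T.Adj ≃r U.Adj) {A : Set W}
    (hA : U.IsNontrivialModule A) : T.IsNontrivialModule (f ⁻¹' A) := by
  refine ⟨?_, hA.2.1.preimage f.surjective, ?_⟩
  · intro x hx y hy v hv
    rw [← f.map_rel_iff, ← f.map_rel_iff]
    exact hA.1 _ hx _ hy _ hv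
  · intro h
    refine hA.2.2 (eq_univ_of_forall fun w => ?_)
    obtain ⟨v, rfl⟩ := f.surjective w
    exact (h ▸ mem_univ v : v ∈ f ⁻¹' A)

theorem IsComodule.preimage (f : T.Adj ≃r U.Adj) {A : Set W} (hA : U.IsComodule A) :
    T.IsComodule (f ⁻¹' A) := by
  rcases hA with h | h
  · exact Or.inl (h.preimage f)
  · exact Or.inr (h.preimage f)

/-- A map that preserves the arcs between tournaments of the same order is an isomorphism. -/
theorem isomorphic_of_hom [Finite V] [Finite W] (g : W → V) (hcard : Nat.card W = Nat.card V)
    (hg : ∀ x y, U.Adj x y → T.Adj (g x) (g y)) : T.Isomorphic U := by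
  have hinj : Function.Injective g := by
    intro x y hxy
    by_contra hne
    rcases adj_total (T := U) hne with h | h
    · exact T.irrefl _ (hxy ▸ hg _ _ h)
    · exact T.irrefl _ (hxy ▸ hg _ _ h)
  have hbij := (Nat.bijective_iff_injective_and_card g).mpr ⟨hinj, hcard⟩
  refine ⟨RelIso.symm ⟨Equiv.ofBijective g hbij, ?_⟩⟩
  intro x y
  refine ⟨fun h => ?_, hg x y⟩
  have h : T.Adj (g x) (g y) := h
  rcases adj_total (T := U) (show x ≠ y from fun h' => adj_ne h (congrArg g h')) with h' | h'
  · exact h'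
  · exact (adj_asymm h (hg _ _ h')).elim

/-- The pullback of a tournament along an injective map. -/
def comap (T : Tournament V) (f : W → V) (hf : Function.Injective f) : Tournament W where
  Adj x y := T.Adj (f x) (f y)
  irrefl _ := T.irrefl _
  adj_iff _ _ hxy := T.adj_iff _ _ fun h => hxy (hf h)

theorem le_decompIndex_of_isomorphic [Finite V] {m : ℕ} (hm : 0 < m) (hV : 5 ≤ Nat.card V)
    {S : Tournament (Fin m)} (h : T.Isomorphic (twinSum S)) : m + 2 ≤ 2 * T.decompIndex := by
  obtain ⟨f⟩ := h
  have := card_le_two_mul_decompIndex (T := T) hV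
    (D := fun i : Fin m ⊕ Bool => f ⁻¹' twinBlock i)
    (fun i => (isComodule_twinBlock S hm i).preimage f)
    (fun i j hij => (disjoint_twinBlock i j hij).preimage f)
  simpa using this

/-- The count is tight, so the two singletons are a source `s` and a sink `t`, and all other `M x`
are two-element modules. `S` is the tournament induced on their representatives. -/
theorem IsTransversal.isomorphic_twinSum [Finite V] {X : Set V} {M : V → Set V}
    (ht : T.IsTransversal X M) {m : ℕ} (hV : Nat.card V = 2 * m + 2)
    (hX : X.ncard = m + 2) : ∃ S : Tournament (Fin m), T.Isomorphic (twinSum S) := by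
  obtain ⟨h2, hpair⟩ := ht.ncard_bound.2 (by omega)
  obtain ⟨s, t, hst, hS, hadj⟩ : ∃ s t, s ≠ t ∧ {x | x ∈ X ∧ M x = {x}} = {s, t} ∧ T.Adj s t := by
    obtain ⟨s, t, hst, hS⟩ := ncard_eq_two.mp h2
    rcases adj_total (T := T) hst with h | h
    · exact ⟨s, t, hst, hS, h⟩
    · exact ⟨t, s, hst.symm, by rw [hS, pair_comm], h⟩
  have hs : s ∈ X ∧ M s = {s} := by
    have : s ∈ {x | x ∈ X ∧ M x = {x}} := by rw [hS]; simp
    exact this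
  have ht' : t ∈ X ∧ M t = {t} := by
    have : t ∈ {x | x ∈ X ∧ M x = {x}} := by rw [hS]; simp
    exact this
  have hsource : ∀ u, u ≠ s → T.Adj s u := fun u hu =>
    (ht.extreme_of_singleton hs.1 hs.2 u t hu hst.symm).mpr hadj
  have hsink : ∀ u, u ≠ t → T.Adj u t := by
    intro u hu
    rcases adj_total (T := T) hu with h | h
    · exact h
    · exact (adj_asymm hadj ((ht.extreme_of_singleton ht'.1 ht'.2 u s hu hst).mp h)).elim
  have hP : (X \ {s, t}).ncard = m := by
    have := ncard_sdiff_add_ncard_of_subset (s := {s, t}) (t := X)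
      (by rintro _ (rfl | rfl); exacts [hs.1, ht'.1])
    rw [ncard_pair hst] at this
    omega
  have hblock : ∀ x : ↥(X \ {s, t}), ∃ p : Fin 2 → V, (∀ a, p a ∈ M x) ∧
      (T.Adj (p 0) (p 1)) ∧ T.IsModule (M x) ∧ (∀ a, p a ≠ s) ∧ (∀ a, p a ≠ t) := by
    rintro ⟨x, hx, hx'⟩
    have hMx : M x ≠ {x} := by
      intro h
      apply hx'
      rw [← hS]
      exact ⟨hx, h⟩
    simp only [mem_insert_iff, mem_singleton_iff, not_or] at hx'
    have ns : ∀ u ∈ M x, u ≠ s := by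
      rintro u hu rfl
      exact ht.notMem hx hs.1 hx'.1 hu (by rw [hs.2]; rfl)
    have nt : ∀ u ∈ M x, u ≠ t := by
      rintro u hu rfl
      exact ht.notMem hx ht'.1 hx'.2 hu (by rw [ht'.2]; rfl)
    have hmod : T.IsModule (M x) := by
      rcases (ht.isMin x hx).prop with h | h
      · exact h.1
      -- `(M x)ᶜ` is not a module: it contains `s` and `t`, which `x` distinguishes.
      · have := h.1 s (fun h' => ns s h' rfl) t (fun h' => nt t h' rfl) x
          (fun h' => h' (ht.mem x hx))
        exact (adj_asymm (hsource x hx'.1) (this.mpr (hsink x hx'.2))).elim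
    obtain ⟨a, b, hab, hM⟩ := ncard_eq_two.mp (hpair x hx hMx)
    obtain ⟨a, b, hadj', ha, hb⟩ : ∃ a b, T.Adj a b ∧ a ∈ M x ∧ b ∈ M x := by
      rcases adj_total (T := T) hab with h | h
      · exact ⟨a, b, h, by simp [hM], by simp [hM]⟩
      · exact ⟨b, a, h, by simp [hM], by simp [hM]⟩
    have hp : ∀ c, ![a, b] c ∈ M x := by
      intro c
      fin_cases c
      · exact ha
      · exact hb
    exact ⟨![a, b], hp, hadj', hmod, fun c => ns _ (hp c), fun c => nt _ (hp c)⟩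
  choose p hp hp01 hmod hps hpt using hblock
  let e : Fin m ≃ ↥(X \ {s, t}) :=
    (Finite.equivFinOfCardEq (by rw [Nat.card_coe_set_eq, hP])).symm
  refine ⟨T.comap (fun i => (e i : V)) (Subtype.val_injective.comp e.injective), ?_⟩
  let g : TwinVertex m → V
    | ⟨0, _⟩ => s
    | ⟨1, q⟩ => p (e q.1) q.2
    | ⟨2, _⟩ => t
  have gbot : g twinBot = s := rfl
  have gtop : g twinTop = t := rfl
  have gmid : ∀ i a, g (twinMid i a) = p (e i) a := fun _ _ => rfl
  refine isomorphic_of_hom g (by rw [card_twinVertex, hV]) ?_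
  apply twinVertex_cases
  · apply twinVertex_cases
    · exact fun h => ((twinSum _).irrefl _ h).elim
    · exact fun i a _ => by rw [gbot, gmid]; exact hsource _ (hps _ _)
    · exact fun _ => hadj
  · intro i a
    apply twinVertex_cases
    · exact fun h => (adj_asymm h (twinSum_bot_mid _ i a)).elim
    · intro j b h
      rw [gmid, gmid]
      rcases (twinSum_mid_mid _ i j a b).mp h with h | ⟨rfl, hlt⟩
      · have h : T.Adj (e i) (e j) := h
        have hne := adj_ne h
        have hd := ht.disjoint _ (e i).2.1 _ (e j).2.1 hne
        rw [disjoint_left] at hd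
        have mi := ht.mem _ (e i).2.1
        have mj := ht.mem _ (e j).2.1
        -- The arc between representatives passes to all elements of the two blocks, first along one
        -- module and then along the other.
        have h1 := hmod (e j) _ mj _ (hp (e j) b) _ (hd mi)
        have h2 := hmod (e i) _ mi _ (hp (e i) a) _ (fun h' => hd h' (hp (e j) b))
        have n1 := T.adj_iff (e i) (p (e j) b) (by
          intro h'
          exact hd mi (h' ▸ hp (e j) b))
        have n2 := T.adj_iff (p (e i) a) (p (e j) b) (by
          intro h'
          exact hd (hp (e i) a) (h' ▸ hp (e j) b))
        tauto
      · have h0 : a = 0 ∧ b = 1 := by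
          fin_cases a <;> fin_cases b <;> simp at hlt ⊢
        rw [h0.1, h0.2]
        exact hp01 _
    · exact fun _ => by rw [gtop, gmid]; exact hsink _ (hpt _ _)
  · apply twinVertex_cases
    · exact fun h => (adj_asymm h (twinSum_bot_top _)).elim
    · exact fun i a h => (adj_asymm h (twinSum_mid_top _ i a)).elim
    · exact fun h => ((twinSum _).irrefl _ h).elim

theorem four_mul_decompIndex_le [Finite V] (hV : 5 ≤ Nat.card V) :
    4 * T.decompIndex ≤ Nat.card V + 4 := by
  obtain ⟨X, M, ht⟩ := T.exists_isTransversal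
  obtain ⟨T', h1, h2⟩ := ht.exists_isIndecomposable hV
  have h3 := decompIndex_le (T := T) h1
  have h4 := ht.ncard_bound.1
  omega

/-- For the lower bound take `m = 2n - 1`: the `2n + 1` blocks give `2δ ≥ 2n + 1`, and parity raises
this to `δ ≥ n + 1`. -/
theorem maxDecompIndex_four_mul {n : ℕ} (hn : 2 ≤ n) : maxDecompIndex (4 * n) = n + 1 := by
  obtain ⟨⟨U, hU⟩, hmax⟩ := isGreatest_maxDecompIndex (4 * n)
  apply le_antisymm
  · rw [← hU]
    have := four_mul_decompIndex_le (T := U) (by rw [Nat.card_fin]; omega)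
    rw [Nat.card_fin] at this
    change U.decompIndex ≤ n + 1
    omega
  · have hcard : Nat.card (Fin (4 * n)) = Nat.card (TwinVertex (2 * n - 1)) := by
      rw [card_twinVertex, Nat.card_fin]
      omega
    let e : Fin (4 * n) ≃ TwinVertex (2 * n - 1) :=
      (Finite.card_eq.mp hcard).some
    have h := hmax ⟨(twinSum (transitive (2 * n - 1))).comap e e.injective, rfl⟩
    have h' := le_decompIndex_of_isomorphic
      (T := (twinSum (transitive (2 * n - 1))).comap e e.injective) (by omega)
      (by rw [Nat.card_fin]; omega) ⟨⟨e, Iff.rfl⟩⟩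
    dsimp only at h
    omega

end Isomorphism

end Tournament

/-- For `n ≥ 2`, a finite tournament has `4n` vertices and `δ`-maximal decomposability if and only
if it is isomorphic to `3(1, S.2, 1)` for some tournament `S` with `2n - 1` vertices, where `k` is
the transitive tournament on `k` vertices. -/
theorem theorem6p1 (n : ℕ) (hn : 2 ≤ n) {V : Type*} [Finite V] (T : Tournament V) :
    (Nat.card V = 4 * n ∧ T.HasMaximalDecomposability) ↔
      ∃ S : Tournament (Fin (2 * n - 1)),
        T.Isomorphic ((Tournament.transitive 3).lexSum₃ (Tournament.transitive 1)
          (S.lexProd (Tournament.transitive 2)) (Tournament.transitive 1)) := by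
  open Tournament in
  constructor
  · rintro ⟨hV, h5, hmax⟩
    rw [hV, maxDecompIndex_four_mul hn] at hmax
    obtain ⟨X, M, ht⟩ := T.exists_isTransversal
    obtain ⟨T', h1, h2⟩ := ht.exists_isIndecomposable h5
    have h3 := decompIndex_le (T := T) h1
    have h4 := ht.ncard_bound.1
    -- `n + 1 = δ(T)` gives `2n + 2 ≤ |X| + 1`, while `2|X| ≤ 4n + 2`; hence `|X| = 2n + 1 = (2n -
    -- 1) + 2`.
    exact ht.isomorphic_twinSum (by omega) (by omega)
  · rintro ⟨S, hS⟩
    have hV : Nat.card V = 4 * n := by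
      obtain ⟨f⟩ := hS
      rw [Nat.card_congr f.toEquiv, card_twinVertex]
      omega
    have h5 : 5 ≤ Nat.card V := by omega
    refine ⟨hV, h5, ?_⟩
    have h1 := le_decompIndex_of_isomorphic (by omega) h5 hS
    have h2 := four_mul_decompIndex_le (T := T) h5
    rw [hV, maxDecompIndex_four_mul hn]
    omega
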